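/- There are absolute constants $C\in\mathbb{N}$ and $c>0$ such that for all integers $k\ge 1$ and $d\ge k^C$ there is a set $\mathcal F_k$ of functions $\mathbb{R}^d\to\{\pm1\}$ with the following properties. Here a halfspace is a function $x\mapsto \mathrm{sign}(\langle w,x\rangle+\theta)$ with $w\in\mathbb{R}^d$, $\theta\in\mathbb{R}$, where $\mathrm{sign}(u)=1$ if $u\ge 0$ and $\mathrm{sign}(u)=-1$ otherwise. 1. Every $F\in\mathcal F_k$ is a $k$-decision list of halfspaces: there are at most $k$ halfspaces $h_1,\dots,h_l$ and labels $b_1,\dots,b_{l+1}\in\{\pm1\}$ such that $F(x)=b_i$ for the first $i$ with $h_i(x)=1$, and $F(x)=b_{l+1}$ if there is no such $i$. 2. There are a function $f:\mathbb{R}\to\{\pm1\}$ and a set $S\subset\mathbb{R}^d$ of unit vectors, with $|\langle u,v\rangle|\le d^{-c}$ for all distinct $u,v\in S$, such that $\mathcal F_k=\{x\mapsto f(\langle v,x\rangle) : v\in S\}$. 3. For a target $F:\mathbb{R}^d\to\{\pm1\}$, a $\mathrm{STAT}(\tau)$ oracle answers each (measurable) query $q:\mathbb{R}^d\times[-1,1]\to[-1,1]$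 by a real number within $\tau$ of $\mathbb{E}_{x\sim N(0,I)}[q(x,F(x))]$. An SQ algorithm asks queries adaptively, possibly using internal randomness, and outputs a (measurable) hypothesis $h:\mathbb{R}^d\to\{\pm1\}$. If an SQ algorithm is such that, for every $F\in\mathcal F_k$ and every $\mathrm{STAT}(d^{-ck})$ oracle for $F$, with probability at least $2/3$ over its internal randomness it asks at most $m$ queries and outputs $h$ with $\Pr_{x\sim N(0,I)}[h(x)\ne F(x)]\le \tfrac12-d^{-ck}$, then $m\ge d^{ck}$. 4. For every $F\in\mathcal F_k$ there is a halfspace $\sigma$ with $\mathbb{E}_{x\sim N(0,I)}[F(x)\sigma(x)]\ge \frac{1}{2k}$. -/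

import Mathlib

open MeasureTheory ProbabilityTheory

namespace SQLower

/-- The Euclidean space `ℝ^d`. -/
abbrev E (d : ℕ) : Type := EuclideanSpace ℝ (Fin d)

/-- The standard Gaussian distribution `N(0, I)` on `ℝ^d`. -/
noncomputable abbrev gauss (d : ℕ) : Measure (E d) := stdGaussian (E d)

/-- Boolean labels are the real numbers `1` and `-1`. -/
def IsLabel (y : ℝ) : Prop := y = 1 ∨ y = -1

/-- The halfspace `x ↦ sign (⟨w, x⟩ + θ)`, where `sign u = 1` if `u ≥ 0` and `sign u = -1`
otherwise. -/
noncomputable def halfspace {d : ℕ} (w : E d) (θ : ℝ) (x : E d) : ℝ :=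
  if 0 ≤ inner ℝ w x + θ then 1 else -1

/-- A rule "if `x` lies in the halfspace `(w, θ)` then answer `label`" of a decision list. -/
structure Rule (d : ℕ) where
  weight : E d
  threshold : ℝ
  label : ℝ

/-- The value of a decision list: the label of the first rule that fires on `x`, and the default
label `b` if none does. -/
noncomputable def evalList {d : ℕ} : List (Rule d) → ℝ → E d → ℝ
  | [], b, _ => b
  | r :: L, b, x => if halfspace r.weight r.threshold x = 1 then r.label else evalList L b x

/-- `F` is a `k`-decision list of halfspaces: at most `k` halfspace rules (padding by redundant
rules makes their number exactly `k`) followed by a default label. -/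
def IsDecisionList {d : ℕ} (k : ℕ) (F : E d → ℝ) : Prop :=
  ∃ (L : List (Rule d)) (b : ℝ), L.length ≤ k ∧ (∀ r ∈ L, IsLabel r.label) ∧ IsLabel b ∧
    F = evalList L b

/-- A statistical query `q : ℝ^d × [-1, 1] → [-1, 1]`. The values at labels outside `[-1, 1]`
are irrelevant. -/
structure Query (d : ℕ) where
  toFun : E d × ℝ → ℝ
  measurable : Measurable toFun
  mem_Icc : ∀ x, ∀ y ∈ Set.Icc (-1 : ℝ) 1, toFun (x, y) ∈ Set.Icc (-1 : ℝ) 1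

/-- A hypothesis `h : ℝ^d → {±1}`. -/
structure Hypothesis (d : ℕ) where
  toFun : E d → ℝ
  measurable : Measurable toFun
  isLabel : ∀ x, IsLabel (toFun x)

/-- A (deterministic, adaptive) SQ algorithm: it either stops and outputs a hypothesis, or it
asks a query and continues according to the answer. There is no bound on its running time between
queries. -/
inductive SQAlgorithm (d : ℕ) : Type where
  | output (h : Hypothesis d) : SQAlgorithm d
  | ask (q : Query d) (next : ℝ → SQAlgorithm d) : SQAlgorithm d

/-- The hypothesis that the algorithm outputs when its queries are answered by `O`. -/
def SQAlgorithm.result {d : ℕ} (O : Query d → ℝ) : SQAlgorithm d → Hypothesis d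
  | .output h => h
  | .ask q next => (next (O q)).result O

/-- The number of queries that the algorithm asks when they are answered by `O`. -/
def SQAlgorithm.queryCount {d : ℕ} (O : Query d → ℝ) : SQAlgorithm d → ℕ
  | .output _ => 0
  | .ask q next => (next (O q)).queryCount O + 1

/-- `O` is a `STAT(τ)` oracle for the target `F` under `N(0, I)`: it answers every query `q` up to
an error of at most `τ` in `𝔼[q(x, F(x))]`. -/
def IsSTAT {d : ℕ} (τ : ℝ) (F : E d → ℝ) (O : Query d → ℝ) : Prop :=
  ∀ q : Query d, |O q - ∫ x, q.toFun (x, F x) ∂(gauss d)| ≤ τ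

/-- The 0-1 error `Pr[h(x) ≠ F(x)]` under `N(0, I)`. -/
noncomputable def zeroOneError {d : ℕ} (h F : E d → ℝ) : ℝ :=
  (gauss d).real {x | h x ≠ F x}

/-- The randomized SQ algorithm `A` (a random choice, according to `P`, of a deterministic one)
learns the class `𝓕` under `N(0, I)` within 0-1 error `ε` with at most `m` queries to `STAT(τ)`:
for every target in `𝓕` and every `STAT(τ)` oracle for it, with probability at least `2/3` the
algorithm asks at most `m` queries and outputs a hypothesis of error at most `ε`.
Deterministic algorithms are the case where `Ω` is a point. -/
def Learns {d : ℕ} {Ω : Type} [MeasurableSpace Ω] (P : Measure Ω) (A : Ω → SQAlgorithm d)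
    (𝓕 : Set (E d → ℝ)) (ε τ : ℝ) (m : ℕ) : Prop :=
  ∀ F ∈ 𝓕, ∀ O : Query d → ℝ, IsSTAT τ F O →
    ∃ G : Set Ω, MeasurableSet G ∧ 2 / 3 ≤ P.real G ∧
      ∀ ω ∈ G, (A ω).queryCount O ≤ m ∧ zeroOneError ((A ω).result O).toFun F ≤ ε

end SQLower

/-!
The hard functions are `F_v x = f ⟨v, x⟩` for one step function `f` with at most `k` jumps that is
orthogonal in `L²(γ)`, `γ = N(0, 1)`, to all polynomials of degree less than `k`, and for many
nearly orthogonal directions `v`.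

The step function comes from best `L¹(γ)` approximation: if `p` is the monic polynomial of degree
`k` with least `∫ |p| ∂γ`, the first-order condition says that `sign p` is orthogonal to every
polynomial of smaller degree, and `sign p` changes only at the at most `k` real roots of `p`
(`exists_stepProd_orthogonal`). Being a step function of one direction, it is a decision list of
at most `k` parallel halfspaces (`isDecisionList_stepProd`). As `f` is, up to a constant, a signed
sum of its jump functions and has mean zero, `1 = ∫ f ^ 2` is a sum of at most `k` correlations of
`f` with thresholds, one of which is large (`exists_halfspace_correlation`).

For unit vectors `u`, `v` with inner product `ρ`, the pair `(⟨u, x⟩, ⟨v, x⟩)` has Mehler's kernel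
`M` as density with respect to `γ ⊗ γ`. Here `∫ M ^ 2 = 1 / (1 - ρ ^ 2) = ∑ ρ ^ (2 n)`, while the
normalized Hermite polynomials satisfy `⟨M, e n ⊗ e n⟩ = ρ ^ n`. Bessel's inequality for the
orthonormal family `f ⊗ f`, `e n ⊗ e n` (`n < k`) thus leaves
`⟨M, f ⊗ f⟩ ^ 2 ≤ ρ ^ (2 k) / (1 - ρ ^ 2)` (`sq_integral_ridge_mul_le`); the completeness of the
Hermite polynomials is not needed. The directions are the normalized indicators of the graphs of
polynomials of degree less than `k` over a prime field of about `√d` elements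
(`exists_nearly_orthogonal`).

Finally, only few of nearly uncorrelated targets correlate with any given function
(`card_correlated_le`). An oracle that answers label-independently whenever the tolerance permits
therefore lets each query reveal, and each hypothesis fit, only few targets, and averaging over
the randomness of the algorithm bounds the number of targets (`card_mul_le_of_learns`).
-/

namespace SQLower

/-! ### Gaussian moments, Hermite polynomials and Mehler's kernel -/

section

open Polynomial

/-- The standard normal distribution on the real line. -/
noncomputable abbrev stdNormal : Measure ℝ := gaussianReal 0 1

lemma memLp_pow_stdNormal (n : ℕ) : MemLp (fun x : ℝ => x ^ n) 2 stdNormal := by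
  rcases Nat.eq_zero_or_pos n with rfl | hn
  · simpa using memLp_const (1 : ℝ)
  have h := memLp_id_gaussianReal' (μ := 0) (v := 1) (2 * n : ℕ) (ENNReal.natCast_ne_top _)
  have hm : AEStronglyMeasurable (fun x : ℝ => x ^ n) stdNormal := by fun_prop
  rw [memLp_two_iff_integrable_sq hm]
  have := h.integrable_norm_pow (p := 2 * n) (by omega)
  refine this.congr (.of_forall fun x => ?_)
  simp only [id, Real.norm_eq_abs]
  rw [pow_mul, sq_abs, ← pow_mul, ← pow_mul, mul_comm]

lemma memLp_eval_stdNormal (p : ℝ[X]) : MemLp (fun x => p.eval x) 2 stdNormal := by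
  simp only [eval_eq_sum_range]
  exact memLp_finsetSum _ fun i _ => (memLp_pow_stdNormal i).const_mul _

lemma integrable_eval_stdNormal (p : ℝ[X]) : Integrable (fun x => p.eval x) stdNormal :=
  (memLp_eval_stdNormal p).integrable (by norm_num)

lemma hasDerivAt_gaussianPDFReal (x : ℝ) :
    HasDerivAt (gaussianPDFReal 0 1) (-(x * gaussianPDFReal 0 1 x)) x := by
  have h : HasDerivAt (fun x : ℝ => (√(2 * Real.pi * (1 : NNReal)))⁻¹ *
      Real.exp (-(x - 0) ^ 2 / (2 * (1 : NNReal)))) _ x :=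
    ((((((hasDerivAt_id x).sub_const 0).pow 2).neg).div_const _).exp).const_mul _
  refine h.congr_deriv ?_
  simp [gaussianPDFReal]
  ring

/-- Stein's identity for polynomials. -/
lemma integral_id_mul_eval (p : ℝ[X]) :
    ∫ x, x * p.eval x ∂stdNormal = ∫ x, p.derivative.eval x ∂stdNormal := by
  have hI : ∀ q : ℝ[X], Integrable (fun x => q.eval x * gaussianPDFReal 0 1 x) := by
    intro q
    have := integrable_eval_stdNormal q
    rw [stdNormal, gaussianReal_of_var_ne_zero _ one_ne_zero,
      integrable_withDensity_iff (measurable_gaussianPDF _ _)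
        (.of_forall fun _ => gaussianPDF_lt_top)] at this
    simpa using this
  rw [integral_gaussianReal_eq_integral_smul one_ne_zero,
    integral_gaussianReal_eq_integral_smul one_ne_zero]
  have := integral_mul_deriv_eq_deriv_mul_of_integrable (u := fun x => p.eval x)
    (v := gaussianPDFReal 0 1) (u' := fun x => p.derivative.eval x)
    (v' := fun x => -(x * gaussianPDFReal 0 1 x)) (fun x _ => p.hasDerivAt x)
    (fun x _ => hasDerivAt_gaussianPDFReal x) ?_ (hI _) (hI _)
  · simp only [mul_neg, integral_neg, neg_inj, smul_eq_mul] at this ⊢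
    rw [show (fun x => gaussianPDFReal 0 1 x * (x * p.eval x)) =
      fun x => p.eval x * (x * gaussianPDFReal 0 1 x) by ext; ring, this]
    simp only [mul_comm]
  · refine (hI (-(X * p))).congr (.of_forall fun x => ?_)
    simp; ring

/-- The probabilists' Hermite polynomials with real coefficients. -/
noncomputable def hermiteReal (n : ℕ) : ℝ[X] := (hermite n).map (Int.castRingHom ℝ)

lemma hermiteReal_succ (n : ℕ) :
    hermiteReal (n + 1) = X * hermiteReal n - derivative (hermiteReal n) := by
  simp [hermiteReal, hermite_succ, derivative_map]

lemma hermiteReal_monic (n : ℕ) : (hermiteReal n).Monic := (hermite_monic n).map _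

lemma natDegree_hermiteReal (n : ℕ) : (hermiteReal n).natDegree = n := by
  rw [hermiteReal, (hermite_monic n).natDegree_map, natDegree_hermite]

/-- Rodrigues' formula in integrated form, by iterating Stein's identity. -/
lemma integral_hermiteReal_mul (n : ℕ) (q : ℝ[X]) :
    ∫ x, (hermiteReal n).eval x * q.eval x ∂stdNormal =
      ∫ x, (derivative^[n] q).eval x ∂stdNormal := by
  induction n generalizing q with
  | zero => simp [hermiteReal]
  | succ n ih =>
    rw [Function.iterate_succ_apply, ← ih, hermiteReal_succ]
    have h1 := integral_id_mul_eval (hermiteReal n * q)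
    simp only [derivative_mul, eval_mul, eval_add] at h1
    have i1 := integrable_eval_stdNormal (X * (hermiteReal n * q))
    have i2 := integrable_eval_stdNormal (derivative (hermiteReal n) * q)
    have i3 := integrable_eval_stdNormal (hermiteReal n * derivative q)
    simp only [eval_mul, eval_X] at i1 i2 i3
    rw [integral_add i2 i3] at h1
    simp only [eval_sub, eval_mul, eval_X, sub_mul, mul_assoc]
    rw [integral_sub i1 i2, h1]
    ring

lemma iterate_derivative_of_natDegree_le {n : ℕ} {q : ℝ[X]} (hq : q.natDegree ≤ n) :
    derivative^[n] q = C (n.factorial * q.coeff n) := by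
  rw [eq_C_of_natDegree_le_zero (p := derivative^[n] q)]
  · congr 1
    rw [coeff_iterate_derivative]
    simp [Nat.descFactorial_self]
  · exact (natDegree_iterate_derivative q n).trans (by omega)

lemma integral_hermiteReal_mul_of_natDegree_le {n : ℕ} {q : ℝ[X]} (hq : q.natDegree ≤ n) :
    ∫ x, (hermiteReal n).eval x * q.eval x ∂stdNormal = n.factorial * q.coeff n := by
  rw [integral_hermiteReal_mul, iterate_derivative_of_natDegree_le hq]
  simp

lemma integral_hermiteReal_mul_self (n : ℕ) :
    ∫ x, (hermiteReal n).eval x * (hermiteReal n).eval x ∂stdNormal = n.factorial := by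
  rw [integral_hermiteReal_mul_of_natDegree_le (natDegree_hermiteReal n).le]
  have := hermiteReal_monic n
  rw [Monic, leadingCoeff, natDegree_hermiteReal] at this
  simp [this]

lemma integral_hermiteReal_mul_of_lt {m n : ℕ} (h : m < n) :
    ∫ x, (hermiteReal n).eval x * (hermiteReal m).eval x ∂stdNormal = 0 := by
  rw [integral_hermiteReal_mul_of_natDegree_le (by rw [natDegree_hermiteReal]; exact h.le),
    coeff_eq_zero_of_natDegree_lt (by rwa [natDegree_hermiteReal]), mul_zero]

lemma integral_hermiteReal_mul_of_ne {m n : ℕ} (h : m ≠ n) :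
    ∫ x, (hermiteReal n).eval x * (hermiteReal m).eval x ∂stdNormal = 0 := by
  rcases h.lt_or_gt with h | h
  · exact integral_hermiteReal_mul_of_lt h
  · simp only [mul_comm (eval _ (hermiteReal n))]
    exact integral_hermiteReal_mul_of_lt h

lemma coeff_comp_linear {n : ℕ} {q : ℝ[X]} (hq : q.natDegree ≤ n) (a b : ℝ) :
    (q.comp (C a * X + C b)).natDegree ≤ n ∧
      (q.comp (C a * X + C b)).coeff n = a ^ n * q.coeff n := by
  have hl : (C a * X + C b).natDegree ≤ 1 := natDegree_linear_le
  have hd : (q.comp (C a * X + C b)).natDegree ≤ n :=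
    natDegree_comp_le.trans ((Nat.mul_le_mul hq hl).trans (by simp))
  refine ⟨hd, ?_⟩
  rw [comp_eq_sum_left, sum_over_range' _ (by simp) (n + 1) (by omega), finsetSum_coeff,
    Finset.sum_range_succ, Finset.sum_eq_zero, zero_add, coeff_C_mul]
  · have := coeff_pow_of_natDegree_le (m := n) hl
    rw [mul_one] at this
    rw [this, mul_comm]
    congr 2
    simp
  · intro i hi
    rw [coeff_C_mul, coeff_eq_zero_of_natDegree_lt (n := n), mul_zero]
    have h1 := natDegree_pow_le_of_le i hl
    have h2 := Finset.mem_range.1 hi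
    rw [mul_one] at h1
    exact h1.trans_lt h2

lemma map_affine_stdNormal {ρ s : ℝ} (x : ℝ) :
    stdNormal.map (fun z => ρ * x + s * z) = gaussianReal (ρ * x) (.mk (s ^ 2) (sq_nonneg s)) := by
  have : (fun z => ρ * x + s * z) = (fun z => ρ * x + z) ∘ (fun z => s * z) := rfl
  rw [this, ← Measure.map_map (by fun_prop) (by fun_prop), gaussianReal_map_const_mul,
    gaussianReal_map_const_add]
  simp

/-- The law of the pair `(X, ρ X + s Z)` for independent standard normal `X` and `Z`; these are
`ρ`-correlated standard normals when `ρ ^ 2 + s ^ 2 = 1`. -/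
noncomputable def correlatedPair (ρ s : ℝ) : Measure (ℝ × ℝ) :=
  (stdNormal.prod stdNormal).map fun p => (p.1, ρ * p.1 + s * p.2)

/-- The density of a pair of `ρ`-correlated standard normals with respect to the product measure,
where `s ^ 2 = 1 - ρ ^ 2` (Mehler's kernel), as the ratio of the densities of the conditional law
`N(ρ x, s ^ 2)` and of `N(0, 1)`. For `s = 0` it has the junk value `0`. -/
noncomputable def mehler (ρ s x y : ℝ) : ℝ :=
  gaussianPDFReal (ρ * x) (.mk (s ^ 2) (sq_nonneg s)) y / gaussianPDFReal 0 1 y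

lemma measurable_mehler (ρ s : ℝ) : Measurable fun p : ℝ × ℝ => mehler ρ s p.1 p.2 := by
  unfold mehler gaussianPDFReal
  fun_prop

lemma mehler_nonneg (ρ s x y : ℝ) : 0 ≤ mehler ρ s x y :=
  div_nonneg (gaussianPDFReal_nonneg _ _ _) (gaussianPDFReal_nonneg _ _ _)

lemma withDensity_mehler {ρ s : ℝ} (hs : s ≠ 0) (x : ℝ) :
    stdNormal.withDensity (fun y => ENNReal.ofReal (mehler ρ s x y)) =
      gaussianReal (ρ * x) (.mk (s ^ 2) (sq_nonneg s)) := by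
  have hv : NNReal.mk (s ^ 2) (sq_nonneg s) ≠ 0 := by
    intro h; exact hs (pow_eq_zero_iff two_ne_zero |>.1 (congrArg NNReal.toReal h))
  have hm : Measurable fun y => mehler ρ s x y := by unfold mehler gaussianPDFReal; fun_prop
  rw [stdNormal, gaussianReal_of_var_ne_zero _ one_ne_zero, gaussianReal_of_var_ne_zero _ hv,
    ← withDensity_mul _ (measurable_gaussianPDF _ _) hm.ennreal_ofReal]
  congr 1
  ext y
  have h0 := gaussianPDFReal_pos 0 1 y one_ne_zero
  simp only [Pi.mul_apply, gaussianPDF]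
  rw [← ENNReal.ofReal_mul h0.le, mehler, mul_div_cancel₀ _ h0.ne']

lemma correlatedPair_eq_withDensity {ρ s : ℝ} (hs : s ≠ 0) :
    correlatedPair ρ s = (stdNormal.prod stdNormal).withDensity
      (fun p => ENNReal.ofReal (mehler ρ s p.1 p.2)) := by
  have hM := (measurable_mehler ρ s).ennreal_ofReal
  refine Measure.ext_of_lintegral _ fun F hF => ?_
  rw [correlatedPair, lintegral_map hF (by fun_prop),
    lintegral_prod (fun p : ℝ × ℝ => F (p.1, ρ * p.1 + s * p.2))
      (hF.comp (by fun_prop)).aemeasurable,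
    lintegral_withDensity_eq_lintegral_mul _ hM hF, lintegral_prod _ (hM.mul hF).aemeasurable]
  refine lintegral_congr fun x => ?_
  have hFx : Measurable fun y => F (x, y) := hF.comp (by fun_prop)
  have hMx : Measurable fun y => ENNReal.ofReal (mehler ρ s x y) :=
    hM.comp (f := fun y : ℝ => (x, y)) (by fun_prop)
  have := lintegral_map (μ := stdNormal) (g := fun z => ρ * x + s * z) hFx (by fun_prop)
  rw [map_affine_stdNormal, ← withDensity_mehler hs,
    lintegral_withDensity_eq_lintegral_mul _ hMx hFx] at this
  exact this.symm

lemma integral_mehler_mul {ρ s : ℝ} (hs : s ≠ 0) {F : ℝ × ℝ → ℝ} (hF : Measurable F) :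
    ∫ p, mehler ρ s p.1 p.2 * F p ∂(stdNormal.prod stdNormal) =
      ∫ p : ℝ × ℝ, F (p.1, ρ * p.1 + s * p.2) ∂(stdNormal.prod stdNormal) := by
  rw [← integral_map (φ := fun p : ℝ × ℝ => (p.1, ρ * p.1 + s * p.2)) (by fun_prop)
    hF.aestronglyMeasurable]
  change _ = ∫ p, F p ∂(correlatedPair ρ s)
  rw [correlatedPair_eq_withDensity hs,
    integral_withDensity_eq_integral_toReal_smul (measurable_mehler ρ s).ennreal_ofReal
      (.of_forall fun _ => ENNReal.ofReal_lt_top)]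
  simp [ENNReal.toReal_ofReal (mehler_nonneg _ _ _ _)]

lemma map_add_stdNormal {ρ s : ℝ} (h : ρ ^ 2 + s ^ 2 = 1) :
    (stdNormal.prod stdNormal).map (fun p => ρ * p.1 + s * p.2) = stdNormal := by
  have := gaussianReal_conv_gaussianReal (m₁ := 0) (m₂ := 0) (v₁ := (.mk (ρ ^ 2) (sq_nonneg ρ)))
    (v₂ := (.mk (s ^ 2) (sq_nonneg s)))
  rw [Measure.conv] at this
  have e1 := gaussianReal_map_const_mul (μ := 0) (v := 1) ρ
  have e2 := gaussianReal_map_const_mul (μ := 0) (v := 1) s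
  simp only [mul_zero, mul_one] at e1 e2
  rw [← e1, ← e2, Measure.map_prod_map _ _ (by fun_prop) (by fun_prop),
    Measure.map_map (by fun_prop) (by fun_prop)] at this
  have e3 : NNReal.mk (ρ ^ 2) (sq_nonneg ρ) + NNReal.mk (s ^ 2) (sq_nonneg s) = 1 := by
    ext; exact h
  rw [e3, add_zero] at this
  exact this

/-- The Hermite polynomials diagonalize the noise operator. For fixed `z`, the polynomial
`x ↦ H n (ρ x + s z)` has degree at most `n` and `n`-th coefficient `ρ ^ n`, which is all that
`H n` sees of it. -/
lemma integral_hermiteReal_noise {ρ s : ℝ} (h : ρ ^ 2 + s ^ 2 = 1) (n : ℕ) :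
    ∫ p : ℝ × ℝ, (hermiteReal n).eval p.1 * (hermiteReal n).eval (ρ * p.1 + s * p.2)
      ∂(stdNormal.prod stdNormal) = ρ ^ n * n.factorial := by
  have m1 : MemLp (fun p : ℝ × ℝ => (hermiteReal n).eval p.1) 2 (stdNormal.prod stdNormal) :=
    (memLp_eval_stdNormal (hermiteReal n)).comp_measurePreserving measurePreserving_fst
  have m2 : MemLp (fun p : ℝ × ℝ => (hermiteReal n).eval (ρ * p.1 + s * p.2)) 2
      (stdNormal.prod stdNormal) :=
    (memLp_eval_stdNormal (hermiteReal n)).comp_measurePreserving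
      (f := fun p : ℝ × ℝ => ρ * p.1 + s * p.2) ⟨by fun_prop, map_add_stdNormal h⟩
  have hi : Integrable (fun p : ℝ × ℝ => (hermiteReal n).eval p.1 *
      (hermiteReal n).eval (ρ * p.1 + s * p.2)) (stdNormal.prod stdNormal) := m1.integrable_mul m2
  rw [integral_prod_symm _ hi]
  have key : ∀ z : ℝ, ∫ x, (hermiteReal n).eval x * (hermiteReal n).eval (ρ * x + s * z)
      ∂stdNormal = ρ ^ n * n.factorial := by
    intro z
    obtain ⟨h1, h2⟩ := coeff_comp_linear (natDegree_hermiteReal n).le ρ (s * z)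
    have := integral_hermiteReal_mul_of_natDegree_le h1
    rw [h2] at this
    have hc := hermiteReal_monic n
    rw [Monic, leadingCoeff, natDegree_hermiteReal] at hc
    simp only [eval_comp, eval_add, eval_mul, eval_C, eval_X, hc] at this
    rw [this]; ring
  simp [key]

/-- Completing the square in `y`: the factor in front of the normal density is the integral of
`mehler ρ s x y ^ 2` over `y`. -/
lemma mehler_sq_mul_gaussianPDFReal {ρ s : ℝ} (hs : 0 < s) (h : ρ ^ 2 + s ^ 2 = 1) (x y : ℝ) :
    mehler ρ s x y ^ 2 * gaussianPDFReal 0 1 y =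
      (s * √(1 + ρ ^ 2))⁻¹ * Real.exp (ρ ^ 2 * x ^ 2 / (1 + ρ ^ 2)) *
        gaussianPDFReal (2 * ρ * x / (1 + ρ ^ 2))
          (.mk (s ^ 2 / (1 + ρ ^ 2)) (by positivity)) y := by
  have hb : 0 < √(1 + ρ ^ 2) := by positivity
  have hb2 : √(1 + ρ ^ 2) ^ 2 = 1 + ρ ^ 2 := Real.sq_sqrt (by positivity)
  have ha : 0 < √(2 * Real.pi) := by positivity
  have hs2 : s ^ 2 = 1 - ρ ^ 2 := by linarith
  have hlt : 0 < 1 - ρ ^ 2 := by nlinarith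
  simp only [mehler, gaussianPDFReal, NNReal.coe_mk, NNReal.coe_one, mul_one, sub_zero]
  rw [Real.sqrt_mul (by positivity) (s ^ 2), Real.sqrt_sq hs.le,
    Real.sqrt_mul (by positivity) (s ^ 2 / _), Real.sqrt_div (by positivity), Real.sqrt_sq hs.le]
  generalize √(2 * Real.pi) = a at *
  have hexp : Real.exp (-(y - ρ * x) ^ 2 / (2 * s ^ 2)) ^ 2 =
      Real.exp (-y ^ 2 / 2) * (Real.exp (ρ ^ 2 * x ^ 2 / (1 + ρ ^ 2)) *
        Real.exp (-(y - 2 * ρ * x / (1 + ρ ^ 2)) ^ 2 / (2 * (s ^ 2 / (1 + ρ ^ 2))))) := by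
    rw [← Real.exp_add, ← Real.exp_add, ← Real.exp_nat_mul]
    congr 1
    have : (1 + ρ ^ 2) ≠ 0 := by positivity
    rw [hs2]
    field_simp
    push_cast
    ring
  rw [div_pow, mul_pow, hexp]
  have := Real.exp_pos (-y ^ 2 / 2)
  field_simp

/-- The integral over `x` of that factor, again read off from a normal density. -/
lemma mehler_norm_mul_gaussianPDFReal {ρ s : ℝ} (hs : 0 < s) (h : ρ ^ 2 + s ^ 2 = 1) (x : ℝ) :
    (s * √(1 + ρ ^ 2))⁻¹ * Real.exp (ρ ^ 2 * x ^ 2 / (1 + ρ ^ 2)) * gaussianPDFReal 0 1 x =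
      (s ^ 2)⁻¹ * gaussianPDFReal 0 (.mk ((1 + ρ ^ 2) / s ^ 2) (by positivity)) x := by
  have hb : 0 < √(1 + ρ ^ 2) := by positivity
  have hb2 : √(1 + ρ ^ 2) ^ 2 = 1 + ρ ^ 2 := Real.sq_sqrt (by positivity)
  have ha : 0 < √(2 * Real.pi) := by positivity
  have hs2 : s ^ 2 = 1 - ρ ^ 2 := by linarith
  have hlt : 0 < 1 - ρ ^ 2 := by nlinarith
  simp only [gaussianPDFReal, NNReal.coe_mk, NNReal.coe_one, mul_one, sub_zero]
  rw [Real.sqrt_mul (by positivity) (_ / s ^ 2), Real.sqrt_div (by positivity),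
    Real.sqrt_sq hs.le]
  have hexp : Real.exp (ρ ^ 2 * x ^ 2 / (1 + ρ ^ 2)) * Real.exp (-x ^ 2 / 2) =
      Real.exp (-x ^ 2 / (2 * ((1 + ρ ^ 2) / s ^ 2))) := by
    rw [← Real.exp_add]
    congr 1
    have : (1 + ρ ^ 2) ≠ 0 := by positivity
    rw [hs2]
    field_simp
    ring
  rw [← hexp]
  field_simp

/-- The squared Hilbert-Schmidt norm of Mehler's kernel, `1 / (1 - ρ ^ 2)`. -/
lemma lintegral_mehler_sq {ρ s : ℝ} (hs : 0 < s) (h : ρ ^ 2 + s ^ 2 = 1) :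
    ∫⁻ p, ENNReal.ofReal (mehler ρ s p.1 p.2 ^ 2) ∂(stdNormal.prod stdNormal) =
      ENNReal.ofReal (s ^ 2)⁻¹ := by
  have hM := ((measurable_mehler ρ s).pow_const 2).ennreal_ofReal
  have hmk : ∀ a (ha : 0 < a), NNReal.mk a ha.le ≠ 0 := fun a ha h0 =>
    ha.ne' (congrArg NNReal.toReal h0)
  have key (a : ℝ) (ha : 0 ≤ a) (g : ℝ → ℝ) (hg : Measurable g) (m : ℝ) (v : NNReal) (hv : v ≠ 0)
      (he : ∀ y, g y * gaussianPDFReal 0 1 y = a * gaussianPDFReal m v y) :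
      ∫⁻ y, ENNReal.ofReal (g y) ∂stdNormal = ENNReal.ofReal a := by
    rw [stdNormal, gaussianReal_of_var_ne_zero _ one_ne_zero,
      lintegral_withDensity_eq_lintegral_mul _ (measurable_gaussianPDF _ _) hg.ennreal_ofReal]
    have : ∀ y, (gaussianPDF 0 1 * fun y => ENNReal.ofReal (g y)) y =
        ENNReal.ofReal a * gaussianPDF m v y := by
      intro y
      simp only [Pi.mul_apply, gaussianPDF]
      rw [← ENNReal.ofReal_mul (gaussianPDFReal_nonneg _ _ _), ← ENNReal.ofReal_mul ha, ← he,
        mul_comm]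
    simp only [this]
    rw [lintegral_const_mul _ (measurable_gaussianPDF _ _), lintegral_gaussianPDF_eq_one _ hv,
      mul_one]
  rw [lintegral_prod _ hM.aemeasurable]
  have h1 : ∀ x, ∫⁻ y, ENNReal.ofReal (mehler ρ s x y ^ 2) ∂stdNormal =
      ENNReal.ofReal ((s * √(1 + ρ ^ 2))⁻¹ * Real.exp (ρ ^ 2 * x ^ 2 / (1 + ρ ^ 2))) :=
    fun x => key _ (by positivity) _ (by unfold mehler gaussianPDFReal; fun_prop) _ _ (hmk _ (by positivity))
      (mehler_sq_mul_gaussianPDFReal hs h x)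
  simp only [h1]
  exact key _ (by positivity) _ (by fun_prop) _ _ (hmk _ (by positivity))
    (mehler_norm_mul_gaussianPDFReal hs h)

lemma memLp_mehler {ρ s : ℝ} (hs : 0 < s) (h : ρ ^ 2 + s ^ 2 = 1) :
    MemLp (fun p : ℝ × ℝ => mehler ρ s p.1 p.2) 2 (stdNormal.prod stdNormal) := by
  have hm := measurable_mehler ρ s
  rw [memLp_two_iff_integrable_sq hm.aestronglyMeasurable]
  refine ⟨(hm.pow_const 2).aestronglyMeasurable, ?_⟩
  rw [hasFiniteIntegral_iff_ofReal (.of_forall fun _ => sq_nonneg _), lintegral_mehler_sq hs h]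
  exact ENNReal.ofReal_lt_top

lemma integral_mehler_sq {ρ s : ℝ} (hs : 0 < s) (h : ρ ^ 2 + s ^ 2 = 1) :
    ∫ p, mehler ρ s p.1 p.2 ^ 2 ∂(stdNormal.prod stdNormal) = (s ^ 2)⁻¹ := by
  rw [integral_eq_lintegral_of_nonneg_ae (.of_forall fun _ => sq_nonneg _)
    ((measurable_mehler ρ s).pow_const 2).aestronglyMeasurable, lintegral_mehler_sq hs h,
    ENNReal.toReal_ofReal (by positivity)]

/-- Bessel's inequality for the products `φ i ⊗ φ i` of an orthonormal family. -/
lemma sum_sq_integral_le {ι : Type*} [Fintype ι] [DecidableEq ι] {φ : ι → ℝ → ℝ}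
    (hφ : ∀ i, MemLp (φ i) 2 stdNormal)
    (ho : ∀ i j, ∫ x, φ i x * φ j x ∂stdNormal = if i = j then 1 else 0)
    {K : ℝ × ℝ → ℝ} (hK : MemLp K 2 (stdNormal.prod stdNormal)) :
    ∑ i, (∫ p, K p * (φ i p.1 * φ i p.2) ∂(stdNormal.prod stdNormal)) ^ 2 ≤
      ∫ p, K p ^ 2 ∂(stdNormal.prod stdNormal) := by
  have hm : ∀ i, MemLp (fun p : ℝ × ℝ => φ i p.1 * φ i p.2) 2 (stdNormal.prod stdNormal) := by
    intro i
    have h1 := (hφ i).integrable_sq.mul_prod (hφ i).integrable_sq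
    have h2 : AEStronglyMeasurable (fun p : ℝ × ℝ => φ i p.1 * φ i p.2)
        (stdNormal.prod stdNormal) :=
      (hφ i).aestronglyMeasurable.comp_fst.mul (hφ i).aestronglyMeasurable.comp_snd
    rw [memLp_two_iff_integrable_sq h2]
    simpa only [mul_pow] using h1
  have hinner : ∀ {f g : ℝ × ℝ → ℝ} (hf : MemLp f 2 (stdNormal.prod stdNormal))
      (hg : MemLp g 2 (stdNormal.prod stdNormal)),
      inner ℝ (hf.toLp f) (hg.toLp g) = ∫ p, f p * g p ∂(stdNormal.prod stdNormal) := by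
    intro f g hf hg
    rw [L2.inner_def]
    refine integral_congr_ae ?_
    filter_upwards [hf.coeFn_toLp, hg.coeFn_toLp] with p h1 h2
    simp [h1, h2, mul_comm]
  have horth : Orthonormal ℝ fun i => (hm i).toLp _ := by
    rw [orthonormal_iff_ite]
    intro i j
    rw [hinner]
    have : ∀ p : ℝ × ℝ, φ i p.1 * φ i p.2 * (φ j p.1 * φ j p.2) =
        (φ i p.1 * φ j p.1) * (φ i p.2 * φ j p.2) := fun p => by ring
    simp only [this]
    rw [integral_prod_mul (fun x => φ i x * φ j x) (fun x => φ i x * φ j x), ho]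
    split_ifs <;> simp
  have := horth.sum_inner_products_le (hK.toLp K) (s := Finset.univ)
  rw [← real_inner_self_eq_norm_sq, hinner] at this
  simp only [hinner, Real.norm_eq_abs, sq_abs] at this
  simpa only [mul_comm (K _), sq (K _)] using this

/-- If a unit vector `f` of `L²(γ)` is orthogonal to all polynomials of degree less than `k`, then
its correlation over a pair of `ρ`-correlated normals is of order `ρ ^ k`. -/
theorem sq_integral_correlated_le {ρ s : ℝ} (hs : 0 < s) (h : ρ ^ 2 + s ^ 2 = 1) {k : ℕ}
    {f : ℝ → ℝ} (hf : Measurable f) (hf1 : ∀ x, f x * f x = 1)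
    (horth : ∀ q : ℝ[X], q.natDegree < k → ∫ x, f x * q.eval x ∂stdNormal = 0) :
    (∫ p : ℝ × ℝ, f p.1 * f (ρ * p.1 + s * p.2) ∂(stdNormal.prod stdNormal)) ^ 2 ≤
      ρ ^ (2 * k) / (1 - ρ ^ 2) := by
  let φ : Option (Fin k) → ℝ → ℝ
    | none => f
    | some n => fun x => (√(n : ℕ).factorial)⁻¹ * (hermiteReal n).eval x
  have hfm : MemLp f 2 stdNormal := by
    refine MemLp.of_bound hf.aestronglyMeasurable 1 (.of_forall fun x => ?_)
    have := hf1 x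
    rw [Real.norm_eq_abs, abs_le]
    constructor <;> nlinarith
  have hφ : ∀ i, MemLp (φ i) 2 stdNormal := by
    rintro (_ | n)
    · exact hfm
    · exact (memLp_eval_stdNormal _).const_mul _
  have hφm : ∀ i, Measurable (φ i) := by
    rintro (_ | n)
    · exact hf
    · exact (hermiteReal n).continuous.measurable.const_mul _
  have hfh : ∀ n : Fin k, ∫ x, f x * ((√(n : ℕ).factorial)⁻¹ * (hermiteReal n).eval x) ∂stdNormal
      = 0 := by
    intro n
    have := horth (hermiteReal n) (by rw [natDegree_hermiteReal]; exact n.2)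
    simp only [mul_left_comm (f _)]
    rw [integral_const_mul, this, mul_zero]
  have ho : ∀ i j, ∫ x, φ i x * φ j x ∂stdNormal = if i = j then 1 else 0 := by
    rintro (_ | m) (_ | n)
    · simp [φ, hf1]
    · simpa [φ] using hfh n
    · simpa [φ, mul_comm] using hfh m
    · have e : ∀ x, φ (some m) x * φ (some n) x = ((√(m : ℕ).factorial)⁻¹ *
          (√(n : ℕ).factorial)⁻¹) * ((hermiteReal m).eval x * (hermiteReal n).eval x) := by
        intro x; simp only [φ]; ring
      simp only [e]
      rw [integral_const_mul]
      by_cases hmn : m = n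
      · subst hmn
        rw [integral_hermiteReal_mul_self, ← mul_inv, Real.mul_self_sqrt (by positivity)]
        simp [Nat.factorial_ne_zero]
      · rw [integral_hermiteReal_mul_of_ne (fun h => hmn (Fin.ext h.symm))]
        simp [hmn]
  have hB := sum_sq_integral_le hφ ho (memLp_mehler hs h)
  rw [integral_mehler_sq hs h, Fintype.sum_option] at hB
  have hnone := integral_mehler_mul (ρ := ρ) hs.ne' (F := fun p => φ none p.1 * φ none p.2)
    (by have := hφm none; fun_prop)
  have hsome : ∀ n : Fin k, ∫ p : ℝ × ℝ, mehler ρ s p.1 p.2 * (φ (some n) p.1 * φ (some n) p.2)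
      ∂(stdNormal.prod stdNormal) = ρ ^ (n : ℕ) := by
    intro n
    rw [integral_mehler_mul (ρ := ρ) hs.ne' (F := fun p => φ (some n) p.1 * φ (some n) p.2)
      (by have := hφm (some n); fun_prop)]
    have e : ∀ p : ℝ × ℝ, φ (some n) p.1 * φ (some n) (ρ * p.1 + s * p.2) =
        ((√(n : ℕ).factorial)⁻¹ * (√(n : ℕ).factorial)⁻¹) * ((hermiteReal n).eval p.1 *
          (hermiteReal n).eval (ρ * p.1 + s * p.2)) := by
      intro x; simp only [φ]; ring
    simp only [e]
    rw [integral_const_mul, integral_hermiteReal_noise h, ← mul_inv,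
      Real.mul_self_sqrt (by positivity)]
    field_simp
  rw [hnone] at hB
  simp only [hsome, ← pow_mul, mul_comm _ 2] at hB
  rw [Fin.sum_univ_eq_sum_range (fun n => ρ ^ (2 * n))] at hB
  have hlt : 0 < 1 - ρ ^ 2 := by nlinarith
  have hgeom : ∑ n ∈ Finset.range k, ρ ^ (2 * n) = (1 - ρ ^ (2 * k)) / (1 - ρ ^ 2) := by
    rw [eq_div_iff hlt.ne']
    simp only [pow_mul]
    have := geom_sum_mul (ρ ^ 2) k
    linarith
  rw [hgeom, show s ^ 2 = 1 - ρ ^ 2 by linarith] at hB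
  have : (1 - ρ ^ 2)⁻¹ - (1 - ρ ^ (2 * k)) / (1 - ρ ^ 2) = ρ ^ (2 * k) / (1 - ρ ^ 2) := by
    field_simp; ring
  change (∫ p : ℝ × ℝ, f p.1 * f (ρ * p.1 + s * p.2) ∂(stdNormal.prod stdNormal)) ^ 2 + _ ≤ _ at hB
  linarith

end

/-! ### Sign patterns orthogonal to low-degree polynomials -/

section

open Polynomial

/-- A polynomial function as an element of `L¹(γ)`. -/
noncomputable def polyToL1 : ℝ[X] →ₗ[ℝ] Lp ℝ 1 stdNormal where
  toFun p := (integrable_eval_stdNormal p).toL1 _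
  map_add' p q := by
    rw [← Integrable.toL1_add]
    exact Integrable.toL1_eq_toL1_iff _ _ _ _ |>.2 (.of_forall fun x => by simp)
  map_smul' c p := by
    rw [RingHom.id_apply, ← Integrable.toL1_smul]
    exact Integrable.toL1_eq_toL1_iff _ _ _ _ |>.2 (.of_forall fun x => by simp)

lemma norm_polyToL1 (p : ℝ[X]) : ‖polyToL1 p‖ = ∫ x, |p.eval x| ∂stdNormal := by
  change ‖(integrable_eval_stdNormal p).toL1 _‖ = _
  rw [L1.norm_eq_integral_norm]
  refine integral_congr_ae ?_
  filter_upwards [(integrable_eval_stdNormal p).coeFn_toL1] with x hx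
  rw [hx, Real.norm_eq_abs]

/-- A monic polynomial of degree `k` of minimal `L¹(γ)` norm. -/
lemma exists_monic_minimal (k : ℕ) : ∃ p : ℝ[X], p.Monic ∧ p.natDegree = k ∧
    ∀ q ∈ degreeLT ℝ k, ∫ x, |p.eval x| ∂stdNormal ≤ ∫ x, |(p + q).eval x| ∂stdNormal := by
  let W : Submodule ℝ (Lp ℝ 1 stdNormal) := (degreeLT ℝ k).map polyToL1
  have : Module.Finite ℝ (degreeLT ℝ k) := Module.Finite.equiv (degreeLTEquiv ℝ k).symm
  have : FiniteDimensional ℝ W := inferInstance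
  have : ProperSpace W := FiniteDimensional.proper ℝ W
  let v := polyToL1 (X ^ k)
  obtain ⟨⟨w, hw⟩, hmin⟩ := Continuous.exists_forall_le (f := fun w : W => ‖v + w‖)
    (by fun_prop) (by
      refine Filter.tendsto_atTop_mono (fun w : W => ?_)
        (Filter.tendsto_atTop_add_const_right _ (-‖v‖) (tendsto_norm_cocompact_atTop (E := W)))
      have := norm_sub_le (v + (w : Lp ℝ 1 stdNormal)) v
      rw [add_sub_cancel_left] at this
      change ‖(w : Lp ℝ 1 stdNormal)‖ + -‖v‖ ≤ _
      linarith)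
  obtain ⟨q₀, hq₀, rfl⟩ := hw
  have hdeg : q₀.degree < k := mem_degreeLT.1 hq₀
  refine ⟨X ^ k + q₀, monic_X_pow_add hdeg, ?_, fun q hq => ?_⟩
  · rw [natDegree_add_eq_left_of_degree_lt, natDegree_X_pow]
    rwa [degree_X_pow]
  · have := hmin ⟨polyToL1 (q₀ + q), _, add_mem hq₀ hq, rfl⟩
    simp only [v, ← map_add, norm_polyToL1] at this
    rwa [add_assoc]

lemma ae_eval_ne_zero {p : ℝ[X]} (hp : p ≠ 0) : ∀ᵐ x ∂stdNormal, p.eval x ≠ 0 := by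
  have : NullSingletonClass stdNormal := nullSingletonClass_gaussianReal one_ne_zero
  have hfin : (p.roots.toFinset : Set ℝ).Finite := Finset.finite_toSet _
  filter_upwards [hfin.measure_zero stdNormal |> measure_eq_zero_iff_ae_notMem.1] with x hx h0
  exact hx (by simp [hp, h0])

/-- The first-order condition at the minimum: the sign of a monic polynomial of minimal `L¹(γ)`
norm is orthogonal to all polynomials of smaller degree. -/
lemma integral_sign_mul_eq_zero {p q : ℝ[X]} (hp : p ≠ 0)
    (hmin : ∀ t : ℝ, ∫ x, |p.eval x| ∂stdNormal ≤ ∫ x, |(p + C t * q).eval x| ∂stdNormal) :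
    ∫ x, SignType.sign (p.eval x) * q.eval x ∂stdNormal = 0 := by
  have hd := hasDerivAt_integral_of_dominated_loc_of_lip (μ := stdNormal)
    (F := fun t x => |(p + C t * q).eval x|) (F' := fun x => SignType.sign (p.eval x) * q.eval x)
    (x₀ := (0 : ℝ)) (bound := fun x => |q.eval x|) (s := Set.univ) Filter.univ_mem
    (.of_forall fun t => (p + C t * q).continuous.abs.aestronglyMeasurable)
    (integrable_eval_stdNormal _).abs
    ?_ (.of_forall fun x => ?_) (integrable_eval_stdNormal q).abs ?_
  · refine IsLocalMin.hasDerivAt_eq_zero (.of_forall fun t => ?_) hd.2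
    simpa using hmin t
  · have : Measurable fun x => ((SignType.sign (p.eval x) : SignType) : ℝ) := by
      have h1 : Measurable fun y : ℝ => ((SignType.sign y : SignType) : ℝ) := by
        have h2 : Measurable fun y : ℝ => if 0 < y then (1 : ℝ) else if y < 0 then -1 else 0 :=
          Measurable.ite measurableSet_Ioi measurable_const
            (Measurable.ite measurableSet_Iio measurable_const measurable_const)
        convert h2 using 2 with y
        rw [sign_apply]
        split_ifs <;> simp
      exact h1.comp p.continuous.measurable
    exact (this.mul q.continuous.measurable).aestronglyMeasurable
  · rw [lipschitzOnWith_univ]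
    refine LipschitzWith.of_dist_le_mul fun a b => ?_
    simp only [Real.dist_eq, eval_add, eval_mul, eval_C, Real.coe_nnabs, abs_abs]
    refine (abs_abs_sub_abs_le_abs_sub _ _).trans ?_
    rw [← abs_mul]
    apply le_of_eq; congr 1; ring
  · filter_upwards [ae_eval_ne_zero hp] with x hx
    have h1 : HasDerivAt (fun t : ℝ => p.eval x + t * q.eval x) (q.eval x) 0 := by
      simpa using ((hasDerivAt_id (0 : ℝ)).mul_const (q.eval x)).const_add (p.eval x)
    have h2 := hasDerivAt_abs (x := p.eval x + 0 * q.eval x) (by simpa using hx)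
    have h3 := h2.comp (0 : ℝ) h1
    simp only [zero_mul, add_zero] at h3
    simpa [Function.comp_def] using h3

/-- The step function `∏ sgn (z - t)` over the points `t` of a list, where `sgn u` is `1` if
`u ≥ 0` and `-1` otherwise. -/
noncomputable def stepProd (L : List ℝ) (z : ℝ) : ℝ :=
  (L.map fun t => if t ≤ z then (1 : ℝ) else -1).prod

@[simp] lemma stepProd_nil (z : ℝ) : stepProd [] z = 1 := rfl

@[simp] lemma stepProd_cons (t : ℝ) (L : List ℝ) (z : ℝ) :
    stepProd (t :: L) z = (if t ≤ z then 1 else -1) * stepProd L z := rfl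

lemma stepProd_isLabel (L : List ℝ) (z : ℝ) : IsLabel (stepProd L z) := by
  induction L with
  | nil => exact .inl rfl
  | cons t L ih =>
    rw [stepProd_cons]
    rcases ih with h | h <;> rw [h] <;> split_ifs <;> simp [IsLabel]

lemma measurable_stepProd (L : List ℝ) : Measurable (stepProd L) := by
  induction L with
  | nil => exact measurable_const
  | cons t L ih =>
    exact (Measurable.ite measurableSet_Ici measurable_const measurable_const).mul ih

lemma eval_pos_of_monic_of_roots_eq_zero {q : ℝ[X]} (hq : q.Monic) (hr : q.roots = 0) (x : ℝ) :
    0 < q.eval x := by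
  by_contra! hx
  by_cases hd : q.natDegree = 0
  · rw [hq.natDegree_eq_zero.1 hd, eval_one] at hx
    linarith
  have ht := q.tendsto_atTop_of_leadingCoeff_nonneg
    (natDegree_pos_iff_degree_pos.1 (Nat.pos_of_ne_zero hd)) (by rw [hq.leadingCoeff]; norm_num)
  obtain ⟨y, hy, hxy⟩ := ((ht.eventually_ge_atTop 0).and (Filter.eventually_ge_atTop x)).exists
  obtain ⟨z, -, hz⟩ := intermediate_value_Icc hxy q.continuous.continuousOn ⟨hx, hy⟩
  have : z ∈ q.roots := (mem_roots hq.ne_zero).2 hz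
  simp [hr] at this

/-- Away from its roots, the sign of a monic real polynomial is that of the product of its real
linear factors, since the complementary factor has no real zero. -/
lemma sign_eval_eq_stepProd {p : ℝ[X]} (hp : p.Monic) : ∀ x, p.eval x ≠ 0 →
    (SignType.sign (p.eval x) : ℝ) = stepProd (p.roots.sort (· ≥ ·)) x := by
  intro x hx
  obtain ⟨q, hq, -, hr⟩ := exists_prod_multiset_X_sub_C_mul p
  have hqm : q.Monic := (monic_multisetProd_X_sub_C p.roots).of_mul_monic_left (by rwa [hq])
  have hpos := eval_pos_of_monic_of_roots_eq_zero hqm hr x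
  have hev : ∀ L : List ℝ, (((L : Multiset ℝ).map fun a => X - C a).prod.eval x ≠ 0) →
      (SignType.sign (((L : Multiset ℝ).map fun a => X - C a).prod.eval x) : ℝ) =
        stepProd L x := by
    intro L
    induction L with
    | nil => simp
    | cons t L ih =>
      intro h
      rw [← Multiset.cons_coe, Multiset.map_cons, Multiset.prod_cons, eval_mul] at h ⊢
      rw [sign_mul, SignType.coe_mul, ih (right_ne_zero_of_mul h), stepProd_cons]
      congr 1
      have hne : x - t ≠ 0 := by simpa using left_ne_zero_of_mul h
      rcases lt_or_gt_of_ne hne with h1 | h1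
      · simp [sign_neg h1, not_le.2 (sub_neg.1 h1)]
      · simp [sign_pos h1, (sub_pos.1 h1).le]
  rw [← hq, eval_mul] at hx ⊢
  rw [sign_mul, sign_pos hpos, mul_one, hq]
  have := hev (p.roots.sort (· ≥ ·))
  rw [Multiset.sort_eq] at this
  exact this (left_ne_zero_of_mul hx)

/-- A sign pattern with at most `k` jumps that is orthogonal to all polynomials of degree less
than `k`. -/
theorem exists_stepProd_orthogonal (k : ℕ) : ∃ L : List ℝ, L.length ≤ k ∧
    L.Pairwise (· ≥ ·) ∧
    ∀ q : ℝ[X], q.natDegree < k → ∫ x, stepProd L x * q.eval x ∂stdNormal = 0 := by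
  obtain ⟨p, hp, hdeg, hmin⟩ := exists_monic_minimal k
  refine ⟨p.roots.sort (· ≥ ·), ?_, Multiset.pairwise_sort _ _, fun q hq => ?_⟩
  · rw [Multiset.length_sort, ← hdeg]; exact p.card_roots'
  · have h0 := integral_sign_mul_eq_zero (q := q) hp.ne_zero fun t => hmin _ <| by
      rw [mem_degreeLT]
      exact degree_le_natDegree.trans_lt (by exact_mod_cast (natDegree_C_mul_le _ _).trans_lt hq)
    rw [← h0]
    refine integral_congr_ae ?_
    filter_upwards [ae_eval_ne_zero hp.ne_zero] with x hx
    rw [sign_eval_eq_stepProd hp x hx]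

end

/-! ### Step functions of one direction -/

lemma stepProd_eq_one {L : List ℝ} {z : ℝ} (h : ∀ t ∈ L, t ≤ z) : stepProd L z = 1 := by
  induction L with
  | nil => rfl
  | cons t L ih =>
    rw [stepProd_cons, if_pos (h t (by simp)), ih fun u hu => h u (by simp [hu]), one_mul]

lemma halfspace_eq_one_iff {d : ℕ} (w : E d) (θ : ℝ) (x : E d) :
    halfspace w θ x = 1 ↔ 0 ≤ inner ℝ w x + θ := by
  unfold halfspace
  split_ifs with h <;> simp [h]; norm_num

/-- Since `L` is decreasing, the first rule `⟨v, x⟩ ≥ t` that fires leaves only nonnegative factors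
behind it, so the value is the sign collected from the rules before it. -/
lemma isDecisionList_stepProd {d : ℕ} (v : E d) {L : List ℝ} (hL : L.Pairwise (· ≥ ·)) {k : ℕ}
    (hk : L.length ≤ k) : IsDecisionList k fun x => stepProd L (inner ℝ v x) := by
  have key : ∀ (L : List ℝ), L.Pairwise (· ≥ ·) → ∀ b : ℝ, IsLabel b →
      ∃ (R : List (Rule d)) (b' : ℝ), R.length = L.length ∧ (∀ r ∈ R, IsLabel r.label) ∧
        IsLabel b' ∧ ∀ x, evalList R b' x = b * stepProd L (inner ℝ v x) := by
    intro L
    induction L with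
    | nil => exact fun _ b hb => ⟨[], b, rfl, by simp, hb, fun x => by simp [evalList]⟩
    | cons t L ih =>
      intro hL b hb
      rw [List.pairwise_cons] at hL
      obtain ⟨R, b', h1, h2, h3, h4⟩ := ih hL.2 (-b) (by rcases hb with rfl | rfl <;> simp [IsLabel])
      refine ⟨⟨v, -t, b⟩ :: R, b', by simp [h1], ?_, h3, fun x => ?_⟩
      · simpa [hb] using h2
      · rw [evalList, stepProd_cons, h4]
        simp only [halfspace_eq_one_iff]
        by_cases h : t ≤ inner ℝ v x
        · rw [if_pos (by linarith), if_pos h, stepProd_eq_one fun u hu => (hL.1 u hu).trans h]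
          simp
        · rw [if_neg (by linarith), if_neg h]
          ring
  obtain ⟨R, b', h1, h2, h3, h4⟩ := key L hL 1 (.inl rfl)
  exact ⟨R, b', h1.trans_le hk, h2, h3, funext fun x => by rw [h4, one_mul]⟩

lemma map_inner_stdGaussian {d : ℕ} {v : E d} (hv : ‖v‖ = 1) :
    (gauss d).map (fun x => inner ℝ v x) = stdNormal := by
  have h := IsGaussian.map_eq_gaussianReal (μ := gauss d) (innerSL ℝ v)
  rw [integral_strongDual_stdGaussian, variance_dual_stdGaussian, innerSL_apply_norm, hv] at h
  simpa using h

lemma map_inner_prod_stdGaussian {d : ℕ} {u w : E d} (hu : ‖u‖ = 1) (hw : ‖w‖ = 1)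
    (huw : inner ℝ u w = (0 : ℝ)) :
    (gauss d).map (fun x => ((inner ℝ u x : ℝ), (inner ℝ w x : ℝ))) = stdNormal.prod stdNormal := by
  have hG : HasGaussianLaw (fun x : E d => ((inner ℝ u x : ℝ), (inner ℝ w x : ℝ))) (gauss d) :=
    IsGaussian.hasGaussianLaw_id.map_fun ((innerSL ℝ u).prod (innerSL ℝ w))
  have hcov : cov[fun x => (inner ℝ u x : ℝ), fun x => (inner ℝ w x : ℝ); gauss d] = 0 := by
    rw [← covarianceBilin_apply_eq_cov IsGaussian.memLp_two_id, covarianceBilin_stdGaussian]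
    exact huw
  have hind := hG.indepFun_of_covariance_eq_zero hcov
  rw [indepFun_iff_map_prod_eq_prod_map_map (by fun_prop) (by fun_prop)] at hind
  rw [hind, map_inner_stdGaussian hu, map_inner_stdGaussian hw]

/-- Gram-Schmidt: `v = ρ u + s w` with `w` a unit vector orthogonal to `u`. -/
lemma map_inner_pair_stdGaussian {d : ℕ} {u v : E d} (hu : ‖u‖ = 1) (hv : ‖v‖ = 1) {s : ℝ}
    (hs : 0 < s) (h : (inner ℝ u v) ^ 2 + s ^ 2 = 1) :
    (gauss d).map (fun x => ((inner ℝ u x : ℝ), (inner ℝ v x : ℝ))) =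
      correlatedPair (inner ℝ u v) s := by
  set ρ : ℝ := inner ℝ u v with hρ
  let w : E d := s⁻¹ • (v - ρ • u)
  have huw : inner ℝ u w = (0 : ℝ) := by
    simp [w, inner_smul_right, inner_sub_right, hu, hρ]
  have hw : ‖w‖ = 1 := by
    have h1 : ‖v - ρ • u‖ ^ 2 = s ^ 2 := by
      rw [norm_sub_sq_real, inner_smul_right, real_inner_comm, ← hρ, hv, norm_smul, hu,
        Real.norm_eq_abs, mul_one, sq_abs]
      linarith
    rw [norm_smul, (sq_eq_sq₀ (norm_nonneg _) hs.le).1 h1, norm_inv, Real.norm_of_nonneg hs.le,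
      inv_mul_cancel₀ hs.ne']
  rw [correlatedPair, ← map_inner_prod_stdGaussian hu hw huw,
    Measure.map_map (by fun_prop) (by fun_prop)]
  congr 1
  ext x
  · simp
  · simp only [Function.comp_apply, w, inner_smul_left, inner_sub_left, RCLike.conj_to_real]
    field_simp
    ring

open Polynomial in
/-- Two ridge functions with the same profile, orthogonal to low-degree polynomials, are
nearly uncorrelated in nearly orthogonal directions. -/
theorem sq_integral_ridge_mul_le {d k : ℕ} {f : ℝ → ℝ} (hf : Measurable f)
    (hf1 : ∀ x, f x * f x = 1)
    (horth : ∀ q : ℝ[X], q.natDegree < k → ∫ x, f x * q.eval x ∂stdNormal = 0)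
    {u v : E d} (hu : ‖u‖ = 1) (hv : ‖v‖ = 1) (huv : |inner ℝ u v| < 1) :
    (∫ x, f (inner ℝ u x) * f (inner ℝ v x) ∂(gauss d)) ^ 2 ≤
      (inner ℝ u v) ^ (2 * k) / (1 - (inner ℝ u v) ^ 2) := by
  have hlt : (inner ℝ u v : ℝ) ^ 2 < 1 := by rwa [sq_lt_one_iff_abs_lt_one]
  have hs : 0 < √(1 - (inner ℝ u v : ℝ) ^ 2) := Real.sqrt_pos.2 (by linarith)
  have h : (inner ℝ u v : ℝ) ^ 2 + √(1 - (inner ℝ u v : ℝ) ^ 2) ^ 2 = 1 := by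
    rw [Real.sq_sqrt (by linarith)]; ring
  have hF : Measurable fun p : ℝ × ℝ => f p.1 * f p.2 := by fun_prop
  have e1 := integral_map (μ := gauss d)
    (φ := fun x => ((inner ℝ u x : ℝ), (inner ℝ v x : ℝ))) (by fun_prop)
    (f := fun p : ℝ × ℝ => f p.1 * f p.2) hF.aestronglyMeasurable
  rw [map_inner_pair_stdGaussian hu hv hs h, correlatedPair,
    integral_map (by fun_prop) hF.aestronglyMeasurable] at e1
  rw [← e1]
  exact sq_integral_correlated_le hs h hf hf1 horth

/-- A step function with at most `k` jumps and mean zero correlates with one of its jump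
functions: by the telescoping `f_{t :: L} = -f_L + (1 + sgn (z - t))`, it is, up to a constant, a
signed sum of them. The bound `1 / k` holds as well; the factor `2` spares the discussion of the
case of equality. -/
lemma exists_threshold_correlation {k : ℕ} {L : List ℝ}
    (hL : L.Pairwise (· ≥ ·)) (hlen : L.length ≤ k) (h0 : ∫ z, stepProd L z ∂stdNormal = 0) :
    ∃ t : ℝ, 1 / (2 * (k : ℝ)) ≤ |∫ z, stepProd L z * stepProd [t] z ∂stdNormal| := by
  by_contra! hcon
  have hint : ∀ L' : List ℝ, Integrable (fun z => stepProd L z * stepProd L' z) stdNormal := by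
    intro L'
    refine Integrable.of_bound
      ((measurable_stepProd L).mul (measurable_stepProd L')).aestronglyMeasurable 1
      (.of_forall fun z => ?_)
    rcases stepProd_isLabel L z with h | h <;> rcases stepProd_isLabel L' z with h' | h' <;>
      simp [h, h']
  have key : ∀ L' : List ℝ, L'.Pairwise (· ≥ ·) →
      |∫ z, stepProd L z * stepProd L' z ∂stdNormal| ≤ L'.length * (1 / (2 * (k : ℝ))) := by
    intro L'
    induction L' with
    | nil => simp [h0]
    | cons t L' ih =>
      intro hL'
      rw [List.pairwise_cons] at hL'
      have e : ∀ z, stepProd L z * stepProd (t :: L') z =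
          stepProd L z * stepProd [] z + stepProd L z * stepProd [t] z -
            stepProd L z * stepProd L' z := by
        intro z
        rw [stepProd_cons, stepProd_cons, stepProd_nil]
        split_ifs with h
        · rw [stepProd_eq_one fun u hu => (hL'.1 u hu).trans h]; ring
        · ring
      simp only [e]
      have hadd : Integrable (fun z => stepProd L z * stepProd [] z + stepProd L z * stepProd [t] z)
          stdNormal := (hint _).add (hint _)
      rw [integral_sub hadd (hint _), integral_add (hint _) (hint _)]
      have h1 := ih hL'.2
      have h2 := hcon t
      simp only [stepProd_nil, mul_one, h0, zero_add]
      rw [List.length_cons]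
      push_cast
      have := abs_sub (∫ z, stepProd L z * stepProd [t] z ∂stdNormal)
        (∫ z, stepProd L z * stepProd L' z ∂stdNormal)
      linarith
  have h1 := key L hL
  have h2 : ∀ z, stepProd L z * stepProd L z = 1 := by
    intro z
    rcases stepProd_isLabel L z with h | h <;> simp [h]
  simp only [h2, integral_const, probReal_univ, smul_eq_mul, mul_one, abs_one] at h1
  have hk : (L.length : ℝ) ≤ k := by exact_mod_cast hlen
  have h3 : (L.length : ℝ) * (1 / (2 * (k : ℝ))) ≤ 1 / 2 := by
    rcases Nat.eq_zero_or_pos k with rfl | hk0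
    · simp
    · have : (0 : ℝ) < k := by exact_mod_cast hk0
      rw [mul_one_div, div_le_div_iff₀ (by positivity) (by norm_num)]
      linarith
  linarith

lemma integral_inner_eq {d : ℕ} {v : E d} (hv : ‖v‖ = 1) {g : ℝ → ℝ} (hg : Measurable g) :
    ∫ x, g (inner ℝ v x) ∂(gauss d) = ∫ z, g z ∂stdNormal := by
  rw [← map_inner_stdGaussian hv, integral_map (by fun_prop) hg.aestronglyMeasurable]

/-- The mean-zero step function in direction `v` correlates with a halfspace. -/
lemma exists_halfspace_correlation {d k : ℕ} {v : E d} (hv : ‖v‖ = 1) {L : List ℝ}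
    (hL : L.Pairwise (· ≥ ·)) (hlen : L.length ≤ k) (h0 : ∫ z, stepProd L z ∂stdNormal = 0) :
    ∃ (w : E d) (θ : ℝ),
      1 / (2 * (k : ℝ)) ≤ ∫ x, stepProd L (inner ℝ v x) * halfspace w θ x ∂(gauss d) := by
  obtain ⟨t, ht⟩ := exists_threshold_correlation hL hlen h0
  have hm : Measurable fun z => stepProd L z * stepProd [t] z :=
    (measurable_stepProd L).mul (measurable_stepProd [t])
  rw [← integral_inner_eq hv hm] at ht
  rcases le_abs.1 ht with h | h
  · refine ⟨v, -t, h.trans_eq (integral_congr_ae (.of_forall fun x => ?_))⟩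
    simp [halfspace, ← sub_eq_add_neg]
  · refine ⟨-v, t, h.trans_eq ?_⟩
    rw [← integral_neg]
    -- The opposite halfspace is the complement only off the null hyperplane `⟨v, x⟩ = t`.
    have hne : ∀ᵐ x ∂(gauss d), (inner ℝ v x : ℝ) ≠ t := by
      have : NullSingletonClass stdNormal := nullSingletonClass_gaussianReal one_ne_zero
      have h1 : ∀ᵐ z ∂stdNormal, z ≠ t := by
        simp [ae_iff]
      rw [← map_inner_stdGaussian hv] at h1
      exact ae_of_ae_map (f := fun x : E d => (inner ℝ v x : ℝ)) (by fun_prop) h1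
    refine integral_congr_ae ?_
    filter_upwards [hne] with x hx
    simp only [stepProd_cons, stepProd_nil, mul_one, halfspace, inner_neg_left]
    rcases lt_or_gt_of_ne hx with h | h
    · rw [if_neg (not_le.2 h), if_pos (by linarith)]; ring
    · rw [if_pos h.le, if_neg (by linarith)]; ring

/-! ### Nearly orthogonal directions -/

section Code

variable {p d : ℕ} [Fact p.Prime]

/-- The normalized indicator vector of the graph of `P`, with `φ` identifying the points of the
plane over `ZMod p` with some of the coordinates. -/
noncomputable def graphVector (φ : ZMod p × ZMod p ↪ Fin d) (P : ZMod p → ZMod p) : E d :=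
  (√(p : ℝ))⁻¹ • ∑ x, EuclideanSpace.single (φ (x, P x)) (1 : ℝ)

lemma inner_graphVector (φ : ZMod p × ZMod p ↪ Fin d) (P Q : ZMod p → ZMod p) :
    (inner ℝ (graphVector φ P) (graphVector φ Q) : ℝ) =
      (Finset.univ.filter fun x => P x = Q x).card / p := by
  have hp : (√(p : ℝ))⁻¹ * (√(p : ℝ))⁻¹ = (p : ℝ)⁻¹ := by
    rw [← mul_inv, Real.mul_self_sqrt (by positivity)]
  have h1 : ∀ x y : ZMod p, (inner ℝ (EuclideanSpace.single (φ (x, P x)) (1 : ℝ))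
      (EuclideanSpace.single (φ (y, Q y)) (1 : ℝ)) : ℝ) =
        if x = y then (if P x = Q x then 1 else 0) else 0 := by
    intro x y
    rw [EuclideanSpace.inner_single_left]
    by_cases h : x = y
    · subst h; simp
    · simp [h]
  rw [graphVector, graphVector, real_inner_smul_left, real_inner_smul_right, ← mul_assoc, hp,
    sum_inner]
  simp only [inner_sum, h1, Finset.sum_ite_eq, Finset.mem_univ, if_true]
  rw [Finset.sum_boole, div_eq_inv_mul]

open Polynomial in
/-- Graphs of polynomials of degree less than `k` over a prime field (the Reed-Solomon code) meet
in fewer than `k` points, so their normalized indicators are nearly orthogonal. -/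
theorem exists_nearly_orthogonal {k : ℕ} (hk : 1 ≤ k) (hkp : k ≤ p) (hpd : p * p ≤ d) :
    ∃ S : Finset (E d), S.card = p ^ k ∧ (∀ v ∈ S, ‖v‖ = 1) ∧
      ∀ u ∈ S, ∀ v ∈ S, u ≠ v → |inner ℝ u v| ≤ ((k : ℝ) - 1) / p := by
  classical
  have hp0 : (0 : ℝ) < p := by exact_mod_cast (Fact.out : p.Prime).pos
  obtain ⟨φ⟩ : Nonempty (ZMod p × ZMod p ↪ Fin d) := by
    apply Function.Embedding.nonempty_of_card_le
    simpa [ZMod.card] using hpd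
  let P : (Fin k → ZMod p) → (ZMod p)[X] := fun a => ((degreeLTEquiv (ZMod p) k).symm a).1
  let vec : (Fin k → ZMod p) → E d := fun a => graphVector φ fun x => (P a).eval x
  have hself : ∀ a, (inner ℝ (vec a) (vec a) : ℝ) = 1 := by
    intro a
    simp only [vec, inner_graphVector, Finset.filter_true, Finset.card_univ, ZMod.card]
    exact div_self hp0.ne'
  have hne : ∀ a b, a ≠ b → |(inner ℝ (vec a) (vec b) : ℝ)| ≤ ((k : ℝ) - 1) / p := by
    intro a b hab
    simp only [vec, inner_graphVector]
    rw [abs_of_nonneg (by positivity)]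
    have hPne : P a - P b ≠ 0 := by
      intro h
      exact hab ((degreeLTEquiv (ZMod p) k).symm.injective (Subtype.ext (sub_eq_zero.1 h)))
    have hdeg : (P a - P b).natDegree < k := by
      rw [natDegree_lt_iff_degree_lt hPne]
      exact mem_degreeLT.1 (sub_mem ((degreeLTEquiv (ZMod p) k).symm a).2
        ((degreeLTEquiv (ZMod p) k).symm b).2)
    have hcard : (Finset.univ.filter fun x => (P a).eval x = (P b).eval x).card ≤ k - 1 := by
      refine le_trans (Finset.card_le_card (t := (P a - P b).roots.toFinset) fun x hx => ?_)
        ((Multiset.toFinset_card_le _).trans ((card_roots' _).trans (by omega)))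
      simp only [Finset.mem_filter, Finset.mem_univ, true_and] at hx
      simp [hPne, hx]
    gcongr
    have : ((k - 1 : ℕ) : ℝ) = (k : ℝ) - 1 := by push_cast [hk]; ring
    rw [← this]
    exact_mod_cast hcard
  have hinj : Function.Injective vec := by
    intro a b hab
    by_contra h
    have h1 := hne a b h
    rw [← hab, hself, abs_one, le_div_iff₀ hp0] at h1
    have : (k : ℝ) ≤ p := by exact_mod_cast hkp
    linarith
  refine ⟨Finset.univ.image vec, ?_, ?_, ?_⟩
  · rw [Finset.card_image_of_injective _ hinj]
    simp [ZMod.card]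
  · intro v hv
    obtain ⟨a, -, rfl⟩ := Finset.mem_image.1 hv
    rw [← sq_eq_sq₀ (norm_nonneg _) zero_le_one, ← real_inner_self_eq_norm_sq, hself, one_pow]
  · intro u hu v hv huv
    obtain ⟨a, -, rfl⟩ := Finset.mem_image.1 hu
    obtain ⟨b, -, rfl⟩ := Finset.mem_image.1 hv
    exact hne a b fun h => huv (by rw [h])

end Code

/-- By Bertrand's postulate, some prime lies between `√d / 2` and `√d`. -/
lemma exists_prime_sqrt {d : ℕ} (hd : 4 ≤ d) :
    ∃ p : ℕ, p.Prime ∧ p * p ≤ d ∧ d < 4 * (p * p) := by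
  have h2 : 2 ≤ Nat.sqrt d := Nat.le_sqrt.2 (by omega)
  obtain ⟨p, hp, h3, h4⟩ := Nat.exists_prime_lt_and_le_two_mul (Nat.sqrt d / 2) (by omega)
  have h5 : p ≤ Nat.sqrt d := by omega
  have h6 : Nat.sqrt d + 1 ≤ 2 * p := by omega
  refine ⟨p, hp, Nat.le_sqrt.1 h5, ?_⟩
  have := Nat.lt_succ_sqrt d
  calc d < (Nat.sqrt d + 1) * (Nat.sqrt d + 1) := this
    _ ≤ (2 * p) * (2 * p) := Nat.mul_le_mul h6 h6
    _ = _ := by ring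

/-! ### The statistical query lower bound -/

/-- Few members of a family of nearly uncorrelated functions correlate with a given function:
this is the nonnegativity of `∫ (∑ ± F i - c h) ^ 2`, where the signs make every `± ∫ F i * h`
at least `τ` and `c` is the total `#T * τ`. -/
lemma card_correlated_le {Ω ι : Type*} [MeasurableSpace Ω] {μ : Measure Ω} [IsProbabilityMeasure μ]
    {F : ι → Ω → ℝ} (hF : ∀ i, Measurable (F i)) (hF1 : ∀ i x, |F i x| ≤ 1)
    {h : Ω → ℝ} (hh : Measurable h) (hh1 : ∀ x, |h x| ≤ 1) {τ γ : ℝ} (hτ : 0 ≤ τ)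
    {T : Finset ι} (hT : ∀ i ∈ T, τ ≤ |∫ x, F i x * h x ∂μ|)
    (hpair : ∀ i ∈ T, ∀ j ∈ T, i ≠ j → |∫ x, F i x * F j x ∂μ| ≤ γ) (hγ : 0 ≤ γ) :
    (T.card : ℝ) * (τ ^ 2 - γ) ≤ 1 := by
  classical
  rcases T.eq_empty_or_nonempty with rfl | hne
  · simp
  have hint : ∀ {a b : Ω → ℝ}, Measurable a → Measurable b → (∀ x, |a x| ≤ 1) →
      (∀ x, |b x| ≤ 1) → Integrable (fun x => a x * b x) μ := by
    intro a b ha hb ha1 hb1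
    refine Integrable.of_bound (ha.mul hb).aestronglyMeasurable 1 (.of_forall fun x => ?_)
    rw [Real.norm_eq_abs, abs_mul]
    exact mul_le_one₀ (ha1 x) (abs_nonneg _) (hb1 x)
  have hle1 : ∀ {a b : Ω → ℝ}, (∀ x, |a x| ≤ 1) →
      (∀ x, |b x| ≤ 1) → ∫ x, a x * b x ∂μ ≤ 1 := by
    intro a b ha1 hb1
    have h1 := norm_integral_le_of_norm_le_const (μ := μ) (f := fun x => a x * b x) (C := 1)
      (.of_forall fun x => by
        rw [Real.norm_eq_abs, abs_mul]
        exact mul_le_one₀ (ha1 x) (abs_nonneg _) (hb1 x))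
    rw [probReal_univ, mul_one] at h1
    exact (le_abs_self _).trans h1
  set s : ι → ℝ := fun i => if 0 ≤ ∫ x, F i x * h x ∂μ then 1 else -1 with hs
  have hs1 : ∀ i, |s i| = 1 := by intro i; simp only [hs]; split_ifs <;> simp
  have hsτ : ∀ i ∈ T, τ ≤ s i * ∫ x, F i x * h x ∂μ := by
    intro i hi
    refine (hT i hi).trans_eq ?_
    simp only [hs]
    split_ifs with h0
    · rw [abs_of_nonneg h0, one_mul]
    · rw [abs_of_neg (not_le.1 h0), neg_one_mul]
  set n : ℝ := (T.card : ℝ) with hn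
  have hn0 : 0 < n := by rw [hn]; exact_mod_cast hne.card_pos
  set c : ℝ := n * τ with hc
  have hexp : ∀ x, (∑ i ∈ T, s i * F i x - c * h x) ^ 2 =
      ∑ i ∈ T, ∑ j ∈ T, s i * s j * (F i x * F j x) - 2 * c * ∑ i ∈ T, s i * (F i x * h x) +
        c ^ 2 * (h x * h x) := by
    intro x
    rw [sub_sq, sq, Finset.sum_mul_sum]
    have e1 : ∑ i ∈ T, ∑ j ∈ T, s i * F i x * (s j * F j x) =
        ∑ i ∈ T, ∑ j ∈ T, s i * s j * (F i x * F j x) :=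
      Finset.sum_congr rfl fun i _ => Finset.sum_congr rfl fun j _ => by ring
    have e2 : ∑ i ∈ T, s i * (F i x * h x) = (∑ i ∈ T, s i * F i x) * h x := by
      rw [Finset.sum_mul]; exact Finset.sum_congr rfl fun i _ => by ring
    rw [e1, e2]; ring
  have i1 : ∀ i j, Integrable (fun x => s i * s j * (F i x * F j x)) μ := fun i j =>
    (hint (hF i) (hF j) (hF1 i) (hF1 j)).const_mul _
  have i2 : ∀ i, Integrable (fun x => s i * (F i x * h x)) μ := fun i =>
    (hint (hF i) hh (hF1 i) hh1).const_mul _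
  have i3 : Integrable (fun x => c ^ 2 * (h x * h x)) μ := (hint hh hh hh1 hh1).const_mul _
  have i4 : Integrable (fun x => ∑ i ∈ T, ∑ j ∈ T, s i * s j * (F i x * F j x)) μ :=
    integrable_finsetSum _ fun i _ => integrable_finsetSum _ fun j _ => i1 i j
  have i5 : Integrable (fun x => 2 * c * ∑ i ∈ T, s i * (F i x * h x)) μ :=
    (integrable_finsetSum _ fun i _ => i2 i).const_mul _
  have i6 : Integrable (fun x => ∑ i ∈ T, ∑ j ∈ T, s i * s j * (F i x * F j x) -
      2 * c * ∑ i ∈ T, s i * (F i x * h x)) μ := i4.sub i5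
  have hnonneg : 0 ≤ ∫ x, (∑ i ∈ T, s i * F i x - c * h x) ^ 2 ∂μ :=
    integral_nonneg fun x => sq_nonneg _
  simp only [hexp] at hnonneg
  rw [integral_add i6 i3, integral_sub i4 i5, integral_const_mul, integral_const_mul,
    integral_finsetSum _ fun i _ => integrable_finsetSum _ fun j _ => i1 i j,
    integral_finsetSum _ fun i _ => i2 i] at hnonneg
  have b1 : ∑ i ∈ T, ∫ x, ∑ j ∈ T, s i * s j * (F i x * F j x) ∂μ ≤ n + n * (n * γ) := by
    have : ∀ i ∈ T, ∫ x, ∑ j ∈ T, s i * s j * (F i x * F j x) ∂μ ≤ 1 + n * γ := by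
      intro i hi
      rw [integral_finsetSum _ fun j _ => i1 i j]
      have hj : ∀ j ∈ T, ∫ x, s i * s j * (F i x * F j x) ∂μ ≤ (if i = j then 1 else 0) + γ := by
        intro j hj
        rw [integral_const_mul]
        by_cases hij : i = j
        · subst hij
          have : s i * s i = 1 := by rw [← abs_mul_abs_self, hs1]; norm_num
          rw [this, if_pos rfl, one_mul]
          linarith [hle1 (hF1 i) (hF1 i)]
        · rw [if_neg hij, zero_add]
          refine (le_abs_self _).trans ?_
          rw [abs_mul, abs_mul, hs1, hs1, one_mul, one_mul]
          exact hpair i hi j hj hij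
      refine (Finset.sum_le_sum hj).trans_eq ?_
      rw [Finset.sum_add_distrib, Finset.sum_ite_eq, if_pos hi, Finset.sum_const, nsmul_eq_mul]
    refine (Finset.sum_le_sum this).trans_eq ?_
    rw [Finset.sum_const, nsmul_eq_mul]; ring
  have b2 : n * τ ≤ ∑ i ∈ T, ∫ x, s i * (F i x * h x) ∂μ := by
    have := Finset.sum_le_sum hsτ
    rw [Finset.sum_const, nsmul_eq_mul] at this
    simpa only [integral_const_mul] using this
  have b3 := hle1 hh1 hh1
  have hc0 : 0 ≤ c := by positivity
  have b4 : 0 ≤ n + n * (n * γ) - 2 * c * (n * τ) + c ^ 2 * 1 := by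
    refine hnonneg.trans ?_
    gcongr
  rw [hc] at b4
  have b5 : 0 ≤ n * (1 - n * (τ ^ 2 - γ)) := by nlinarith
  nlinarith [nonneg_of_mul_nonneg_right b5 hn0]

/-- Along the path that a fixed oracle `O₀` answers, at most `m` queries and one hypothesis decide
what the algorithm does with any oracle under which it asks at most `m` queries. -/
lemma SQAlgorithm.exists_queries {d : ℕ} (O₀ : Query d → ℝ) (A : SQAlgorithm d) (m : ℕ) :
    ∃ (Q : List (Query d)) (h : Hypothesis d), Q.length ≤ m ∧ ∀ O : Query d → ℝ,
      A.queryCount O ≤ m → (∃ q ∈ Q, O q ≠ O₀ q) ∨ A.result O = h := by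
  induction A generalizing m with
  | output h => exact ⟨[], h, by simp, fun O _ => .inr rfl⟩
  | ask q next ih =>
    rcases m with _ | m
    · exact ⟨[], (next (O₀ q)).result O₀, le_rfl, fun O hO => by simp [queryCount] at hO⟩
    · obtain ⟨Q, h, hQ, hO⟩ := ih (O₀ q) m
      refine ⟨q :: Q, h, by simpa using hQ, fun O hc => ?_⟩
      by_cases hq : O q = O₀ q
      · rw [queryCount, hq] at hc
        rcases hO O (by omega) with ⟨q', h1, h2⟩ | h1
        · exact .inl ⟨q', by simp [h1], h2⟩
        · exact .inr (by rw [result, hq, h1])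
      · exact .inl ⟨q, by simp, hq⟩

namespace Query

variable {d : ℕ} (q : Query d)

/-- The label-independent part of a query. -/
noncomputable def even (x : E d) : ℝ := (q.toFun (x, 1) + q.toFun (x, -1)) / 2

/-- The coefficient of the label in a query. -/
noncomputable def odd (x : E d) : ℝ := (q.toFun (x, 1) - q.toFun (x, -1)) / 2

lemma measurable_even : Measurable q.even :=
  ((q.measurable.comp (by fun_prop)).add (q.measurable.comp (by fun_prop))).div_const _

lemma measurable_odd : Measurable q.odd :=
  ((q.measurable.comp (by fun_prop)).sub (q.measurable.comp (by fun_prop))).div_const _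

lemma abs_even_le (x : E d) : |q.even x| ≤ 1 := by
  have h1 := q.mem_Icc x 1 (by norm_num)
  have h2 := q.mem_Icc x (-1) (by norm_num)
  rw [even, abs_le]
  constructor <;> linarith [h1.1, h1.2, h2.1, h2.2]

lemma abs_odd_le (x : E d) : |q.odd x| ≤ 1 := by
  have h1 := q.mem_Icc x 1 (by norm_num)
  have h2 := q.mem_Icc x (-1) (by norm_num)
  rw [odd, abs_le]
  constructor <;> linarith [h1.1, h1.2, h2.1, h2.2]

lemma toFun_eq {y : ℝ} (hy : IsLabel y) (x : E d) : q.toFun (x, y) = q.even x + y * q.odd x := by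
  rcases hy with rfl | rfl <;> simp only [even, odd] <;> ring

end Query

lemma IsLabel.abs_eq {y : ℝ} (h : IsLabel y) : |y| = 1 := by
  rcases h with rfl | rfl <;> simp

/-- A `STAT(τ)` oracle for `F` that ignores the labels whenever the tolerance permits. -/
noncomputable def lazyOracle {d : ℕ} (τ : ℝ) (F : E d → ℝ) (q : Query d) : ℝ :=
  open Classical in
  if |∫ x, F x * q.odd x ∂(gauss d)| ≤ τ then ∫ x, q.even x ∂(gauss d)
  else ∫ x, q.toFun (x, F x) ∂(gauss d)

lemma isSTAT_lazyOracle {d : ℕ} {τ : ℝ} (hτ : 0 ≤ τ) {F : E d → ℝ} (hF : Measurable F)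
    (hFl : ∀ x, IsLabel (F x)) : IsSTAT τ F (lazyOracle τ F) := by
  intro q
  unfold lazyOracle
  split_ifs with h
  · have i1 : Integrable q.even (gauss d) :=
      .of_bound q.measurable_even.aestronglyMeasurable 1 (.of_forall q.abs_even_le)
    have i2 : Integrable (fun x => F x * q.odd x) (gauss d) := by
      refine .of_bound (hF.mul q.measurable_odd).aestronglyMeasurable 1 (.of_forall fun x => ?_)
      rw [Real.norm_eq_abs, abs_mul, (hFl x).abs_eq, one_mul]
      exact q.abs_odd_le x
    simp only [fun x => q.toFun_eq (hFl x) x]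
    rw [integral_add i1 i2, sub_add_cancel_left, abs_neg]
    exact h
  · simpa using hτ

lemma integral_mul_eq_one_sub_zeroOneError {d : ℕ} {F h : E d → ℝ} (hF : Measurable F)
    (hh : Measurable h) (hFl : ∀ x, IsLabel (F x)) (hhl : ∀ x, IsLabel (h x)) :
    ∫ x, F x * h x ∂(gauss d) = 1 - 2 * zeroOneError h F := by
  have hms : MeasurableSet {x | h x ≠ F x} := (measurableSet_eq_fun hh hF).compl
  have e : ∀ x, F x * h x = 1 - 2 * ({x | h x ≠ F x}.indicator 1 x : ℝ) := by
    intro x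
    rcases hFl x with h1 | h1 <;> rcases hhl x with h2 | h2 <;>
      simp [Set.indicator_apply, h1, h2] <;> norm_num
  have hi : Integrable ({x | h x ≠ F x}.indicator (1 : E d → ℝ)) (gauss d) :=
    (integrable_const (1 : ℝ)).indicator hms
  simp only [e]
  rw [integral_sub (integrable_const _) (hi.const_mul _), integral_const_mul,
    integral_indicator_one hms]
  simp [zeroOneError]

/-- The statistical query lower bound for a family of nearly uncorrelated targets: a target on which
a run of the algorithm succeeds correlates with one of the queries, or with the hypothesis, of the
run whose queries are answered by their label-independent parts. -/
theorem card_mul_le_of_learns {d : ℕ} {ι : Type*} {F : ι → E d → ℝ} (hF : ∀ i, Measurable (F i))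
    (hFl : ∀ i x, IsLabel (F i x)) {S : Finset ι} {τ γ : ℝ} (hτ : 0 ≤ τ) (hγ : 0 ≤ γ)
    (hγτ : γ < τ ^ 2)
    (hpair : ∀ i ∈ S, ∀ j ∈ S, i ≠ j → |∫ x, F i x * F j x ∂(gauss d)| ≤ γ)
    {Ω : Type} [MeasurableSpace Ω] {P : Measure Ω} [IsProbabilityMeasure P]
    {A : Ω → SQAlgorithm d} {m : ℕ} {𝓕 : Set (E d → ℝ)} (h𝓕 : ∀ i ∈ S, F i ∈ 𝓕)
    (hA : Learns P A 𝓕 (1 / 2 - τ) τ m) :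
    2 / 3 * (S.card : ℝ) ≤ (m + 1) * (1 / (τ ^ 2 - γ)) := by
  classical
  have hpos : 0 < τ ^ 2 - γ := by linarith
  set B : ℝ := 1 / (τ ^ 2 - γ) with hB
  have hex : ∀ i, ∃ G : Set Ω, i ∈ S → MeasurableSet G ∧ 2 / 3 ≤ P.real G ∧ ∀ ω ∈ G,
      (A ω).queryCount (lazyOracle τ (F i)) ≤ m ∧
        zeroOneError ((A ω).result (lazyOracle τ (F i))).toFun (F i) ≤ 1 / 2 - τ := by
    intro i
    by_cases hi : i ∈ S
    · obtain ⟨G, hG⟩ := hA (F i) (h𝓕 i hi) _ (isSTAT_lazyOracle hτ (hF i) (hFl i))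
      exact ⟨G, fun _ => hG⟩
    · exact ⟨∅, fun h => absurd h hi⟩
  choose G hG using hex
  let T : (E d → ℝ) → Finset ι := fun h => S.filter fun i => τ ≤ |∫ x, F i x * h x ∂(gauss d)|
  have hT : ∀ h : E d → ℝ, Measurable h → (∀ x, |h x| ≤ 1) → ((T h).card : ℝ) ≤ B := by
    intro h hh hh1
    have := card_correlated_le (μ := gauss d) hF (fun i x => (hFl i x).abs_eq.le) hh hh1 hτ
      (T := T h) (fun i hi => (Finset.mem_filter.1 hi).2)
      (fun i hi j hj => hpair i (Finset.mem_filter.1 hi).1 j (Finset.mem_filter.1 hj).1) hγ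
    rwa [hB, le_div_iff₀ hpos]
  have hω : ∀ ω, ((S.filter fun i => ω ∈ G i).card : ℝ) ≤ (m + 1) * B := by
    intro ω
    obtain ⟨Q, h, hQ, hO⟩ :=
      (A ω).exists_queries (fun q => ∫ x, q.even x ∂(gauss d)) m
    have hsub : (S.filter fun i => ω ∈ G i) ⊆
        T h.toFun ∪ Q.toFinset.biUnion fun q => T q.odd := by
      intro i hi
      obtain ⟨hiS, hiG⟩ := Finset.mem_filter.1 hi
      obtain ⟨hc, herr⟩ := (hG i hiS).2.2 ω hiG
      rw [Finset.mem_union, Finset.mem_biUnion]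
      rcases hO _ hc with ⟨q, hq, hne⟩ | hres
      · refine .inr ⟨q, List.mem_toFinset.2 hq, Finset.mem_filter.2 ⟨hiS, ?_⟩⟩
        by_contra! hlt
        exact hne (by rw [lazyOracle, if_pos hlt.le])
      · refine .inl (Finset.mem_filter.2 ⟨hiS, ?_⟩)
        rw [hres] at herr
        rw [integral_mul_eq_one_sub_zeroOneError (hF i) h.measurable (hFl i) h.isLabel]
        exact le_trans (by linarith) (le_abs_self _)
    have hcard : ((S.filter fun i => ω ∈ G i).card : ℝ) ≤
        (T h.toFun).card + ∑ q ∈ Q.toFinset, ((T q.odd).card : ℝ) := by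
      have := (Finset.card_le_card hsub).trans ((Finset.card_union_le _ _).trans
        (Nat.add_le_add_left Finset.card_biUnion_le _))
      exact_mod_cast this
    have hB0 : 0 ≤ B := by positivity
    have hQm : (Q.toFinset.card : ℝ) ≤ m := by
      exact_mod_cast (List.toFinset_card_le Q).trans hQ
    have hs : ∑ q ∈ Q.toFinset, ((T q.odd).card : ℝ) ≤ m * B := by
      refine (Finset.sum_le_card_nsmul _ _ B fun q _ =>
        hT _ q.measurable_odd q.abs_odd_le).trans ?_
      rw [nsmul_eq_mul]
      gcongr
    have := hT h.toFun h.measurable fun x => (h.isLabel x).abs_eq.le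
    linarith
  have hsum : ∑ i ∈ S, P.real (G i) ≤ (m + 1) * B := by
    have hi : ∀ i ∈ S, Integrable ((G i).indicator (1 : Ω → ℝ)) P := fun i hi =>
      (integrable_const (1 : ℝ)).indicator (hG i hi).1
    have e : ∑ i ∈ S, P.real (G i) = ∫ ω, ∑ i ∈ S, (G i).indicator (1 : Ω → ℝ) ω ∂P := by
      rw [integral_finsetSum _ hi]
      exact Finset.sum_congr rfl fun i hiS => (integral_indicator_one (hG i hiS).1).symm
    rw [e]
    refine (integral_mono (integrable_finsetSum _ hi)
      (integrable_const (((m : ℝ) + 1) * B)) fun ω => ?_).trans_eq (by simp)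
    refine le_of_eq_of_le ?_ (hω ω)
    simp [Set.indicator_apply, Finset.sum_boole]
  have hlow : 2 / 3 * (S.card : ℝ) ≤ ∑ i ∈ S, P.real (G i) := by
    rw [mul_comm, ← nsmul_eq_mul]
    exact Finset.card_nsmul_le_sum _ _ _ fun i hi => (hG i hi).2.1
  exact hlow.trans hsum

/-! ### Choice of parameters -/

/-- Nothing is learned to negative error. -/
lemma not_learns_of_neg {d : ℕ} {F : E d → ℝ} (hF : Measurable F) (hFl : ∀ x, IsLabel (F x))
    {𝓕 : Set (E d → ℝ)} (h𝓕 : F ∈ 𝓕) {ε τ : ℝ} (hε : ε < 0) (hτ : 0 ≤ τ) {m : ℕ}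
    {Ω : Type} [MeasurableSpace Ω] {P : Measure Ω} {A : Ω → SQAlgorithm d} :
    ¬ Learns P A 𝓕 ε τ m := by
  intro h
  obtain ⟨G, -, hG, hA⟩ := h F h𝓕 _ (isSTAT_lazyOracle hτ hF hFl)
  rcases G.eq_empty_or_nonempty with rfl | ⟨ω, hω⟩
  · norm_num at hG
  · exact absurd ((hA ω hω).2.trans_lt hε) (not_lt.2 measureReal_nonneg)

lemma measurable_ridge {d : ℕ} (L : List ℝ) (v : E d) :
    Measurable fun x : E d => stepProd L (inner ℝ v x) :=
  (measurable_stepProd L).comp (by fun_prop)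

lemma stepProd_mul_self (L : List ℝ) (z : ℝ) : stepProd L z * stepProd L z = 1 := by
  rcases stepProd_isLabel L z with h | h <;> simp [h]

open Polynomial in
/-- The parameters in the main case, where `X = d ^ (1 / 40)` is at least `2`: with `Y = X ^ k`
there are at least `Y ^ 19` directions, their functions have correlations at most `2 / Y ^ 18`,
and the tolerance is `1 / Y`. -/
lemma exists_hard_directions {k d : ℕ} (hk : 1 ≤ k) {X : ℝ} (hX : 2 ≤ X) (hXd : X ^ 40 = d)
    (hkX : (k : ℝ) ≤ X) {L : List ℝ}
    (horth : ∀ q : ℝ[X], q.natDegree < k → ∫ x, stepProd L x * q.eval x ∂stdNormal = 0) :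
    ∃ S : Finset (E d), (∀ v ∈ S, ‖v‖ = 1) ∧
      (∀ u ∈ S, ∀ v ∈ S, u ≠ v → |inner ℝ u v| ≤ X⁻¹) ∧
      ∀ (Ω : Type) [MeasurableSpace Ω] (P : Measure Ω) [IsProbabilityMeasure P]
        (A : Ω → SQAlgorithm d) (m : ℕ),
        Learns P A ((fun (v x : E d) => stepProd L (inner ℝ v x)) '' S)
          (1 / 2 - (X ^ k)⁻¹) (X ^ k)⁻¹ m → X ^ k ≤ m := by
  have hX0 : 0 < X := by linarith
  have hd4 : 4 ≤ d := by
    have : (2 : ℝ) ^ 40 ≤ d := by rw [← hXd]; gcongr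
    have : 2 ^ 40 ≤ d := by exact_mod_cast this
    omega
  obtain ⟨p, hp, hpd, hdp⟩ := exists_prime_sqrt hd4
  have : Fact p.Prime := ⟨hp⟩
  have hXp : X ^ 20 < 2 * p := by
    have h1 : (d : ℝ) < 4 * (p * p) := by exact_mod_cast hdp
    refine lt_of_pow_lt_pow_left₀ 2 (by positivity) ?_
    rw [← pow_mul, hXd]
    linarith
  have hXp' : X ^ 19 < p := by
    have : X ^ 20 = X * X ^ 19 := by ring
    have : 2 * X ^ 19 ≤ X * X ^ 19 := by gcongr
    linarith
  have hkp : k ≤ p := by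
    have : X ≤ X ^ 19 := le_self_pow₀ (by linarith) (by norm_num)
    have : (k : ℝ) ≤ p := by linarith
    exact_mod_cast this
  obtain ⟨S, hcard, hnorm, hinner⟩ := exists_nearly_orthogonal hk hkp hpd
  have hp0 : (0 : ℝ) < p := by exact_mod_cast hp.pos
  have hin : ∀ u ∈ S, ∀ v ∈ S, u ≠ v → |(inner ℝ u v : ℝ)| ≤ (X ^ 18)⁻¹ := by
    intro u hu v hv huv
    refine (hinner u hu v hv huv).trans ?_
    rw [div_le_iff₀ hp0, inv_mul_eq_div, le_div_iff₀ (by positivity)]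
    calc ((k : ℝ) - 1) * X ^ 18 ≤ X * X ^ 18 := by gcongr; linarith
      _ = X ^ 19 := by ring
      _ ≤ p := hXp'.le
  refine ⟨S, hnorm, fun u hu v hv huv => (hin u hu v hv huv).trans ?_, ?_⟩
  · exact inv_anti₀ hX0 (le_self_pow₀ (by linarith) (by norm_num))
  intro Ω _ P _ A m hA
  set Y : ℝ := X ^ k with hY
  have hY2 : 2 ≤ Y := hX.trans (le_self_pow₀ (by linarith) (by omega))
  have hY0 : 0 < Y := by linarith
  have hpair : ∀ u ∈ S, ∀ v ∈ S, u ≠ v →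
      |∫ x, stepProd L (inner ℝ u x) * stepProd L (inner ℝ v x) ∂(gauss d)| ≤ 2 * (Y ^ 18)⁻¹ := by
    intro u hu v hv huv
    have h1 := hin u hu v hv huv
    have hhalf : |(inner ℝ u v : ℝ)| ≤ 1 / 2 := by
      refine h1.trans ?_
      rw [one_div]
      exact inv_anti₀ (by norm_num) (hX.trans (le_self_pow₀ (by linarith) (by norm_num)))
    have hsq : (inner ℝ u v : ℝ) ^ 2 ≤ 1 / 4 := by
      rw [← sq_abs]
      calc |(inner ℝ u v : ℝ)| ^ 2 ≤ (1 / 2) ^ 2 := by gcongr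
        _ = 1 / 4 := by norm_num
    have h2 := sq_integral_ridge_mul_le (measurable_stepProd L) (stepProd_mul_self L) horth
      (hnorm u hu) (hnorm v hv) (by linarith)
    refine abs_le_of_sq_le_sq (h2.trans ?_) (by positivity)
    rw [div_le_iff₀ (by linarith)]
    have h3 : (inner ℝ u v : ℝ) ^ (2 * k) ≤ ((Y ^ 18)⁻¹) ^ 2 := by
      rw [pow_mul, ← sq_abs, ← pow_mul, mul_comm, pow_mul]
      gcongr
      calc |(inner ℝ u v : ℝ)| ^ k ≤ ((X ^ 18)⁻¹) ^ k := by gcongr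
        _ = (Y ^ 18)⁻¹ := by rw [inv_pow, hY, ← pow_mul, ← pow_mul, mul_comm]
    have h4 : 0 ≤ ((Y ^ 18)⁻¹) ^ 2 := by positivity
    nlinarith
  have hgap : (Y⁻¹) ^ 2 / 2 ≤ (Y⁻¹) ^ 2 - 2 * (Y ^ 18)⁻¹ := by
    have h16 : (4 : ℝ) ≤ Y ^ 16 := by
      calc (4 : ℝ) ≤ 2 ^ 16 := by norm_num
        _ ≤ Y ^ 16 := by gcongr
    have h1 : (Y⁻¹) ^ 2 = Y ^ 16 * (Y ^ 18)⁻¹ := by field_simp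
    have h2 : 0 < (Y ^ 18)⁻¹ := by positivity
    rw [h1]
    nlinarith
  have hτ2 : 0 < (Y⁻¹) ^ 2 := by positivity
  have hmain := card_mul_le_of_learns (F := fun (v x : E d) => stepProd L (inner ℝ v x))
    (measurable_ridge L) (fun v x => stepProd_isLabel L _) (τ := Y⁻¹) (γ := 2 * (Y ^ 18)⁻¹)
    (by positivity) (by positivity) (by linarith) hpair
    (fun v hv => Set.mem_image_of_mem _ hv) hA
  have hS : Y ^ 19 ≤ S.card := by
    rw [hcard, hY, ← pow_mul, mul_comm, pow_mul]
    push_cast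
    gcongr
  have hB : 1 / ((Y⁻¹) ^ 2 - 2 * (Y ^ 18)⁻¹) ≤ 2 * Y ^ 2 := by
    rw [div_le_iff₀ (by linarith)]
    calc (1 : ℝ) = 2 * Y ^ 2 * ((Y⁻¹) ^ 2 / 2) := by field_simp
      _ ≤ _ := by gcongr
  have hm : 2 / 3 * Y ^ 19 ≤ (m + 1) * (2 * Y ^ 2) := by
    refine le_trans ?_ (hmain.trans ?_) <;> gcongr
  have h3 : Y ^ 17 ≤ 3 * (m + 1) := by
    have e : Y ^ 19 = Y ^ 17 * Y ^ 2 := by ring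
    rw [e] at hm
    have hY2' : 0 < Y ^ 2 := by positivity
    nlinarith
  have h5 : 16 * Y ≤ Y ^ 17 := by
    calc 16 * Y ≤ 2 ^ 16 * Y := by gcongr; norm_num
      _ ≤ Y ^ 16 * Y := by gcongr
      _ = Y ^ 17 := by ring
  linarith

end SQLower

theorem proposition3p1 :
    ∃ (C : ℕ) (c : ℝ), 0 < c ∧ ∀ k d : ℕ, 1 ≤ k → k ^ C ≤ d →
      ∃ 𝓕 : Set (SQLower.E d → ℝ),
        (∀ F ∈ 𝓕, SQLower.IsDecisionList k F) ∧
        (∃ (f : ℝ → ℝ) (S : Set (SQLower.E d)),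
          (∀ z, SQLower.IsLabel (f z)) ∧
          (∀ v ∈ S, ‖v‖ = 1) ∧
          (∀ u ∈ S, ∀ v ∈ S, u ≠ v → |inner ℝ u v| ≤ (d : ℝ) ^ (-c)) ∧
          𝓕 = (fun (v x : SQLower.E d) => f (inner ℝ v x)) '' S) ∧
        (∀ (Ω : Type) [MeasurableSpace Ω] (P : Measure Ω) [IsProbabilityMeasure P]
          (A : Ω → SQLower.SQAlgorithm d) (m : ℕ),
          SQLower.Learns P A 𝓕 (1 / 2 - (d : ℝ) ^ (-(c * k))) ((d : ℝ) ^ (-(c * k))) m →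
            (d : ℝ) ^ (c * k) ≤ m) ∧
        (∀ F ∈ 𝓕, ∃ (w : SQLower.E d) (θ : ℝ),
          1 / (2 * (k : ℝ)) ≤ ∫ x, F x * SQLower.halfspace w θ x ∂(SQLower.gauss d)) := by
  open SQLower in
  refine ⟨40, 1 / 40, by norm_num, fun k d hk hkd => ?_⟩
  obtain ⟨L, hlen, hsort, horth⟩ := exists_stepProd_orthogonal k
  have hmean : ∫ z, stepProd L z ∂stdNormal = 0 := by
    simpa using horth 1 (by rw [Polynomial.natDegree_one]; exact hk)
  have hd0 : 0 < d := lt_of_lt_of_le (by positivity) hkd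
  set X : ℝ := (d : ℝ) ^ (1 / 40 : ℝ) with hX
  have hX0 : 0 < X := by positivity
  have hXd : X ^ 40 = d := by
    rw [hX, ← Real.rpow_natCast, ← Real.rpow_mul (by positivity)]
    norm_num
  have hkX : (k : ℝ) ≤ X := by
    refine le_of_pow_le_pow_left₀ (n := 40) (by norm_num) hX0.le ?_
    rw [hXd]
    exact_mod_cast hkd
  have hXk : (d : ℝ) ^ (1 / 40 * (k : ℝ)) = X ^ k := by
    rw [Real.rpow_mul (by positivity), Real.rpow_natCast]
  obtain ⟨S, hnorm, hinner, hlower⟩ : ∃ S : Finset (E d), (∀ v ∈ S, ‖v‖ = 1) ∧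
      (∀ u ∈ S, ∀ v ∈ S, u ≠ v → |inner ℝ u v| ≤ X⁻¹) ∧
      ∀ (Ω : Type) [MeasurableSpace Ω] (P : Measure Ω) [IsProbabilityMeasure P]
        (A : Ω → SQAlgorithm d) (m : ℕ),
        Learns P A ((fun (v x : E d) => stepProd L (inner ℝ v x)) '' S)
          (1 / 2 - (X ^ k)⁻¹) (X ^ k)⁻¹ m → X ^ k ≤ m := by
    rcases le_or_gt 2 X with h2 | h2
    · exact exists_hard_directions hk h2 hXd hkX horth
    -- Here `k = 1` and `d ^ (-c) > 1 / 2`: the required error is negative, one direction will do.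
    · have hk1 : k = 1 := by
        have : (k : ℝ) < 2 := hkX.trans_lt h2
        have : k < 2 := by exact_mod_cast this
        omega
      subst hk1
      have hinv : 1 / 2 < X⁻¹ := by
        rw [one_div]; exact inv_strictAnti₀ hX0 h2
      refine ⟨{EuclideanSpace.single ⟨0, hd0⟩ 1}, by simp, ?_, ?_⟩
      · intro u hu v hv huv
        rw [Finset.mem_singleton] at hu hv
        exact absurd (hu.trans hv.symm) huv
      · intro Ω _ P _ A m hA
        rw [pow_one] at hA
        exact absurd hA (not_learns_of_neg (measurable_ridge L _) (fun x => stepProd_isLabel L _)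
          (Set.mem_image_of_mem _ (Finset.mem_coe.2 (Finset.mem_singleton_self _)))
          (by linarith) (by positivity))
  refine ⟨(fun (v x : E d) => stepProd L (inner ℝ v x)) '' S, ?_, ⟨stepProd L, S,
    stepProd_isLabel L, hnorm, ?_, rfl⟩, ?_, ?_⟩
  · rintro _ ⟨v, -, rfl⟩
    exact isDecisionList_stepProd v hsort hlen
  · rwa [Real.rpow_neg (by positivity)]
  · rwa [Real.rpow_neg (by positivity), hXk]
  · rintro _ ⟨v, hv, rfl⟩
    exact exists_halfspace_correlation (hnorm v hv) hsort hlen hmean
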